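/- **Setting.** Let $d\ge 1$, let $\mathcal X\subseteq[0,1]^d$ be measurable, $Y=\{-1,1\}$, and let $\rho$ be a probability measure on $\mathcal X\times Y$ with marginal $\rho_X$ on $\mathcal X$ and conditional distribution $\rho(y|x)$. Put $\eta(x)=\rho(y=1|x)$; the Bayes rule is $f_c(x)=1$ if $\rho(y=1|x)\ge\rho(y=-1|x)$ and $f_c(x)=-1$ otherwise. Let $B_\delta(x)=\{x'\in\mathcal X:\|x'-x\|_\infty\le\delta\}$, $\operatorname{sgn}(t)=1$ for $t\ge 0$ and $-1$ for $t<0$, and for $g:\mathcal X\to\{-1,1\}$ $$\mathcal R(g)=\int \mathbf 1_{\{yg(x)=-1\}}\,d\rho,\qquad \mathcal R^\delta(g)=\int\max_{x'\in B_\delta(x)}\mathbf 1_{\{yg(x')=-1\}}\,d\rho,$$ and let $\mathcal R^\delta_*=\mathcal R^\delta(f_c^\delta)$ be the minimum of $\mathcal R^\delta$ over measurable classifiers $\mathcal X\to\{-1,1\}$. Let $\|J_\rho\|$ and $\|\bar J_\rho\|$ be the operator norms of the identity maps $L^1(\mathcal X)\to L^1_{\rho_X}(\mathcal X)$ and $L^1_{\rho_X}(\mathcal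 X)\to L^1(\mathcal X)$, where $L^1(\mathcal X)$ is taken with Lebesgue measure. For $L\ge1$ and widths $\vec d=(d_1,\dots,d_L)$, with $d_0=d$, $\mathcal F_{\vec d,L}$ is the set of functions $f(x)=c\cdot\sigma\circ\mathcal A_L\circ\cdots\circ\sigma\circ\mathcal A_1(x)$ on $\mathcal X$ with affine maps $\mathcal A_\ell:\mathbb R^{d_{\ell-1}}\to\mathbb R^{d_\ell}$, $c\in\mathbb R^{d_L}$ and $\sigma(t)=\max\{t,0\}$ componentwise. For a sample $D=\{(x_i,y_i)\}_{i=1}^n$ drawn i.i.d. from $\rho$, the adversarial training global minima are the minimizers over $\mathcal F_{\vec d,L}$ of $$\frac1n\sum_{i=1}^n\ \max_{x'\in B_\delta(x_i)}\phi(y_if(x')),\qquad \phi(t)=\max\{1-t,0\}$$ (the maximum is read as a supremum if it is not attained). Let $q_X=\frac12\min_{i\ne j}\|x_i-x_j\|_\infty$, with $q_X=\infty$ if $n=1$. **Theorem.** Let $d,\alpha\ge1$ be integers and $K\ge0$. There is a constant $C$, depending only on $d,\alpha,K$, and for every $\delta>0$ there is a constant $C_\delta$, depending only on $d,\alpha,K,\delta$,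 such that the following holds. Suppose that * $\|J_\rho\|<\infty$ and $\|\bar J_\rho\|<\infty$; * $\|x_A-x_B\|_\infty\ge2\delta$ whenever $x_A,x_B\in\mathcal X$, $f_c(x_A)=1$, $f_c(x_B)=-1$; * $\eta\in W^\alpha_\infty(\mathcal X)$ with norm at most $K$, i.e. $\eta$ is the restriction to $\mathcal X$ of a $C^{\alpha-1}$ function on $[0,1]^d$ with Lipschitz derivatives of order $\alpha-1$, for which the sup norms of the derivatives of order at most $\alpha-1$, plus the Lipschitz constant of those of order $\alpha-1$, sum to at most $K$; * $\zeta>0$ and $|\eta(x)-\frac12|>\zeta$ for all $x\in\mathcal X$. Then for every $n\ge1$ and every $C_0\in(0,1]$ there are a depth $L\ge 1$ and widths $\vec d=(d_1,\dots,d_L)$ with $$L\le C\log\tfrac1\zeta,\qquad d_1,\dots,d_L\le C\big(\zeta^{-d/\alpha}\log\tfrac1\zeta+n\big),\qquad d_2,\dots,d_L\le C_\delta\,\zeta^{-d/\alpha}\log\tfrac1\zeta,$$ and a sequence of learning rules $D\mapsto\widehat f_{D,j}\in\mathcal F_{\vec d,L}$, $j\in\mathbb N$, such that for every sample $D$ of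 size $n$ with $\delta<q_X/3$ the functions $\widehat f_{D,j}$, $j\in\mathbb N$, are pairwise distinct global minima of adversarial training over $\mathcal F_{\vec d,L}$, each of them given by a network with at most $C(\zeta^{-d/\alpha}\log\frac1\zeta+n)$ non-zero parameters, and $$\mathcal R(\operatorname{sgn}\widehat f_{D,j})-\mathcal R(f_c)\le2\|J_\rho\|\big((2+2C_0)\delta\big)^dn,\qquad \mathcal R^\delta(\operatorname{sgn}\widehat f_{D,j})-\mathcal R^\delta_*\le3\|J_\rho\|\big((4+2C_0)\delta\big)^dn.$$ Moreover, for every $j$ these two excess errors are integrable in $D$, and their expectations, conditional on $\delta<q_X/3$, satisfy $$\mathbb E\big[\mathcal R(\operatorname{sgn}\widehat f_{D,j})-\mathcal R(f_c)\big]\le2\|J_\rho\|\big((2+2C_0)\delta\big)^dn,\qquad \mathbb E\big[\mathcal R^\delta(\operatorname{sgn}\widehat f_{D,j})-\mathcal R^\delta_*\big]\le3\|J_\rho\|\big((4+2C_0)\delta\big)^dn.$$ -/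

import Mathlib

open MeasureTheory ProbabilityTheory
open scoped ENNReal NNReal

noncomputable section

namespace AdvTraining

/-- The label set `Y = {-1, 1}`. -/
abbrev Label : Type := ({-1, 1} : Set ℝ)

/-- The unit cube `[0,1]^d`.  Points carry the `ℓ_∞` norm of `Fin d → ℝ`. -/
def cube (d : ℕ) : Set (Fin d → ℝ) := Set.Icc 0 1

/-- The sign function with the convention `sgn 0 = 1`. -/
def sgn (t : ℝ) : ℝ := if 0 ≤ t then 1 else -1

/-- The hinge loss. -/
def hinge (t : ℝ) : ℝ := max (1 - t) 0

/-! ### Deep ReLU networks -/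

/-- Layer dimensions: the input dimension is `d`, and layer `ℓ + 1` has width `w ℓ`. -/
def layerDim (d : ℕ) (w : ℕ → ℕ) : ℕ → ℕ
  | 0 => d
  | ℓ + 1 => w ℓ

/-- The parameters of a fully connected network of depth `L` with input dimension `d`, whose
layers `1, …, L` have widths `w 0, …, w (L - 1)`.  Only the matrices and biases with index
`ℓ < L` are used; those with index `ℓ` define the affine map into layer `ℓ + 1`. -/
structure Net (d : ℕ) (w : ℕ → ℕ) (L : ℕ) where
  weight : (ℓ : ℕ) → Matrix (Fin (layerDim d w (ℓ + 1))) (Fin (layerDim d w ℓ)) ℝ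
  bias : (ℓ : ℕ) → Fin (layerDim d w (ℓ + 1)) → ℝ
  coeff : Fin (layerDim d w L) → ℝ

namespace Net

variable {d : ℕ} {w : ℕ → ℕ} {L : ℕ}

/-- The output of layer `ℓ` (after the ReLU activation). -/
def layer (N : Net d w L) (x : Fin d → ℝ) : (ℓ : ℕ) → Fin (layerDim d w ℓ) → ℝ
  | 0 => x
  | ℓ + 1 => fun i => max ((N.weight ℓ).mulVec (layer N x ℓ) i + N.bias ℓ i) 0

/-- `f(x) = c · σ ∘ A_L ∘ ⋯ ∘ σ ∘ A_1 (x)`. -/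
def eval (N : Net d w L) (x : Fin d → ℝ) : ℝ := ∑ i, N.coeff i * N.layer x L i

/-- The number of non-zero free parameters. -/
def numNonzero (N : Net d w L) : ℕ :=
  (Finset.univ.filter fun i => N.coeff i ≠ 0).card +
    ∑ ℓ ∈ Finset.range L,
      ((Finset.univ.filter fun p : Fin (layerDim d w (ℓ + 1)) × Fin (layerDim d w ℓ) =>
          N.weight ℓ p.1 p.2 ≠ 0).card +
        (Finset.univ.filter fun i => N.bias ℓ i ≠ 0).card)

end Net

/-- The function on `X` that the network `N` computes. -/
def Net.toFun {d : ℕ} {w : ℕ → ℕ} {L : ℕ} (X : Set (Fin d → ℝ)) (N : Net d w L) : X → ℝ :=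
  fun x => N.eval (x : Fin d → ℝ)

/-- The hypothesis space: all functions on `X` computed by networks of the given depth and
widths. -/
def hypothesisSpace {d : ℕ} (X : Set (Fin d → ℝ)) (w : ℕ → ℕ) (L : ℕ) : Set (X → ℝ) :=
  Set.range fun N : Net d w L => N.toFun X

/-! ### Samples and adversarial training -/

variable {d n : ℕ} {X : Set (Fin d → ℝ)}

/-- The separation distance `q = (1/2) min_{i ≠ j} ‖x_i - x_j‖_∞` of the inputs of a sample
(`∞` if there is only one input). -/
def sepDist (D : Fin n → X × Label) : ℝ≥0∞ :=
  (⨅ (i : Fin n) (j : Fin n) (_ : i ≠ j), edist (D i).1 (D j).1) / 2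

/-- The samples with `δ < q / 3`. -/
def admissible (X : Set (Fin d → ℝ)) (n : ℕ) (δ : ℝ) : Set (Fin n → X × Label) :=
  {D | ENNReal.ofReal δ < sepDist D / 3}

/-- The empirical adversarial hinge risk.  The metric of `X` is the `ℓ_∞` metric, so
`Metric.closedBall x δ` is `{x' ∈ X : ‖x' - x‖_∞ ≤ δ}`. -/
def empAdvRisk (D : Fin n → X × Label) (δ : ℝ) (f : X → ℝ) : ℝ :=
  (1 / (n : ℝ)) *
    ∑ i, ⨆ x' : Metric.closedBall (D i).1 δ, hinge (((D i).2 : ℝ) * f x')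

/-- The global minima of adversarial training over the networks of depth `L` and widths `w`. -/
def globalMinima (D : Fin n → X × Label) (δ : ℝ) (w : ℕ → ℕ) (L : ℕ) : Set (X → ℝ) :=
  {f | f ∈ hypothesisSpace X w L ∧ IsMinOn (empAdvRisk D δ) (hypothesisSpace X w L) f}

/-! ### Population risks -/

/-- The misclassification error: the probability that `y g(x) = -1`. -/
def misclass (ρ : Measure (X × Label)) (g : X → ℝ) : ℝ :=
  ρ.real {z | (z.2 : ℝ) * g z.1 = -1}

/-- The adversarial misclassification error: the integral of
`max_{x' ∈ B_δ(x)} 1_{y g(x') = -1}`, that is, the probability that `y g(x') = -1` for some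
`x' ∈ X` with `‖x' - x‖_∞ ≤ δ`. -/
def advMisclass (ρ : Measure (X × Label)) (δ : ℝ) (g : X → ℝ) : ℝ :=
  ρ.real {z | ∃ x' ∈ Metric.closedBall z.1 δ, (z.2 : ℝ) * g x' = -1}

/-- The smallest adversarial misclassification error of a classifier `X → {-1, 1}`. -/
def bestAdvMisclass (ρ : Measure (X × Label)) (δ : ℝ) : ℝ :=
  ⨅ g : {g : X → ℝ // Measurable g ∧ ∀ x, g x = 1 ∨ g x = -1}, advMisclass ρ δ g.1

/-- `η(x) = ρ(y = 1 | x)`, for a conditional distribution `κ` of the label given the input. -/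
def eta (κ : Kernel X Label) (x : X) : ℝ := (κ x).real {y | (y : ℝ) = 1}

/-- The Bayes rule: `1` if `ρ(y = 1 | x) ≥ ρ(y = -1 | x)`, and `-1` otherwise. -/
def bayes (κ : Kernel X Label) (x : X) : ℝ :=
  if (κ x).real {y | (y : ℝ) = -1} ≤ (κ x).real {y | (y : ℝ) = 1} then 1 else -1

/-- The classes `{f_c = 1}` and `{f_c = -1}` are `2δ`-separated in the `ℓ_∞` distance. -/
def Separated (κ : Kernel X Label) (δ : ℝ) : Prop :=
  ∀ a b : X, bayes κ a = 1 → bayes κ b = -1 → 2 * δ ≤ dist a b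

/-- The operator norm of the identity map `L¹(ν) → L¹(μ)` (`∞` if it is not a bounded map). -/
def idNorm {Ω : Type*} [MeasurableSpace Ω] (ν μ : Measure Ω) : ℝ≥0∞ :=
  sInf {c | ∀ f : Ω → ℝ, Measurable f → Integrable f ν → eLpNorm f 1 μ ≤ c * eLpNorm f 1 ν}

/-- `‖J_ρ‖`, the norm of the identity map from `L¹(X)` (Lebesgue measure) to `L¹(ρ_X)`. -/
def normJ (ρ : Measure (X × Label)) : ℝ≥0∞ := idNorm (Measure.comap Subtype.val volume) ρ.fst

/-- The norm of the identity map from `L¹(ρ_X)` to `L¹(X)` (Lebesgue measure). -/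
def normJbar (ρ : Measure (X × Label)) : ℝ≥0∞ := idNorm ρ.fst (Measure.comap Subtype.val volume)

/-! ### Smoothness -/

/-- A norm of `W^α_∞([0,1]^d)`, for an integer `α ≥ 1`: the sup norms of the derivatives of
order at most `α - 1`, plus the Lipschitz constant of the derivatives of order `α - 1`.  All
partial derivatives of one order are collected in one multilinear map, and the `ℓ_∞` distance
is used, which gives an equivalent norm. -/
def holderNorm (d α : ℕ) (F : (Fin d → ℝ) → ℝ) : ℝ≥0∞ :=
  (∑ k ∈ Finset.range α, ⨆ x ∈ cube d, ‖iteratedFDerivWithin ℝ k F (cube d) x‖ₑ) +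
    ⨆ (x ∈ cube d) (y ∈ cube d) (_ : x ≠ y),
      edist (iteratedFDerivWithin ℝ (α - 1) F (cube d) x)
        (iteratedFDerivWithin ℝ (α - 1) F (cube d) y) / edist x y

/-- `g : X → ℝ` belongs to `W^α_∞(X)` with norm at most `K`: it is the restriction to
`X ⊆ [0,1]^d` of an `(α - 1)`-times continuously differentiable function on `[0,1]^d` whose
norm is at most `K`. -/
def HolderBall (α : ℕ) (K : ℝ≥0) (g : X → ℝ) : Prop :=
  ∃ F : (Fin d → ℝ) → ℝ, ContDiffOn ℝ ((α - 1 : ℕ) : WithTop ℕ∞) F (cube d) ∧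
    holderNorm d α F ≤ K ∧ ∀ x : X, F x = g x

end AdvTraining

end

namespace AdvTraining

/-! The empirical adversarial risk is non-negative, so every network function whose margin is at
least `1` on the `δ`-balls around all sample inputs has risk `0` and is a global minimum. It
therefore suffices to interpolate robustly while disturbing the Bayes rule on a small set only.

Let `g` be a network with `|η - g| ≤ ζ` on the domain. Since `|η - 1/2| > ζ`, the sign of `g - 1/2`
is the Bayes rule at every point (`sgn_eq_bayes`). Around each input add a bump of height `2`
carrying the sign of its label. Admissible inputs are more than `6δ` apart, so the bumps do not
interact, and `|g - 1/2| ≤ 1` leaves margin at least `1` (`trained_of_near`). The sum can differ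
from `g - 1/2` only within distance `(1 + C₀)δ` of the inputs (`trained_of_far`), that is, on `n`
cubes whose `ρ_X`-mass is controlled by `‖J_ρ‖`. This bounds the excess risk. For the adversarial
risk the cubes grow by `δ`: elsewhere the Bayes rule is constant on `δ`-balls by separation, and its
standard risk is a lower bound for the best adversarial risk (`advMisclass_sub_le`). Both estimates
have constant `1` in place of `2` and `3`.

Multiplication by `j + 1` keeps signs and margins, and gives infinitely many minima. The bumps are
centred at inputs rounded to a grid, so the rule takes countably many values and integrability in
the sample needs no measurable selection (`integrable_comp_discretize`).

The network `g` glues local Taylor polynomials by a partition of unity made of hats. Each summand is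
a product of functions `max (1 - |t|) 0` with `t` affine, and a network of bounded width multiplies
these with error exponentially small in its depth, through the sawtooth expansion of `y - y ^ 2`
(`exists_realizes_prod`, `exists_realizes_grid`, `exists_realizes_holder`).

All layers get the same width. It contains a multiple of `n`, which a packing bound depending on `d`
and `δ` controls as soon as an admissible sample exists (`card_le_of_admissible`). -/

/-- A ReLU network all of whose hidden layers are indexed by the same type `ι`; it serves for
every depth. -/
structure UniformNet (d : ℕ) (ι : Type) where
  input : ι → Fin d → ℝ
  weight : ℕ → ι → ι → ℝ
  bias : ℕ → ι → ℝ
  coeff : ι → ℝ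

/-! ### Operations on networks and their effect on the number of non-zero parameters. -/

namespace UniformNet

variable {d : ℕ} {ι κ : Type} [Fintype ι] [Fintype κ]

/-- The activations of hidden layer `l + 1`. -/
def state (G : UniformNet d ι) (x : Fin d → ℝ) : ℕ → ι → ℝ
  | 0 => fun i => max (∑ j, G.input i j * x j + G.bias 0 i) 0
  | l + 1 => fun i => max (∑ j, G.weight l i j * state G x l j + G.bias (l + 1) i) 0

/-- The output of the network with `l + 1` hidden layers. -/
def eval (G : UniformNet d ι) (l : ℕ) (x : Fin d → ℝ) : ℝ := ∑ i, G.coeff i * G.state x l i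

open Classical in
/-- The number of non-zero entries of a finite family of reals. -/
noncomputable def nnz {γ : Type} [Fintype γ] (v : γ → ℝ) : ℕ :=
  (Finset.univ.filter fun i => v i ≠ 0).card

/-- The number of non-zero parameters of the network with `l + 1` hidden layers. -/
noncomputable def count (G : UniformNet d ι) (l : ℕ) : ℕ :=
  nnz G.coeff + (nnz (fun p : ι × Fin d => G.input p.1 p.2) + nnz (G.bias 0)) +
    ∑ t ∈ Finset.range l, (nnz (fun p : ι × ι => G.weight t p.1 p.2) + nnz (G.bias (t + 1)))

lemma nnz_le_card {γ : Type} [Fintype γ] (v : γ → ℝ) : nnz v ≤ Fintype.card γ := by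
  classical
  exact Finset.card_le_univ _

lemma nnz_le_of_injective {γ γ' : Type} [Fintype γ] [Fintype γ'] (e : γ → γ')
    (he : Function.Injective e) (v : γ → ℝ) (v' : γ' → ℝ) (h : ∀ i, v i ≠ 0 → v' (e i) ≠ 0) :
    nnz v ≤ nnz v' := by
  classical
  refine Finset.card_le_card_of_injOn e ?_ he.injOn
  intro i hi
  simp only [Finset.coe_filter, Finset.mem_univ, true_and, Set.mem_ofPred_eq] at hi ⊢
  exact h i hi

lemma nnz_zero {γ : Type} [Fintype γ] : nnz (fun _ : γ => (0 : ℝ)) = 0 := by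
  classical
  simp [nnz]

lemma nnz_sum {γ γ' : Type} [Fintype γ] [Fintype γ'] (v : γ ⊕ γ' → ℝ) :
    nnz v = nnz (fun i => v (Sum.inl i)) + nnz (fun i => v (Sum.inr i)) := by
  classical
  simp only [nnz, Finset.card_filter, Fintype.sum_sum_type]

lemma nnz_prod {γ γ' : Type} [Fintype γ] [Fintype γ'] (v : γ × γ' → ℝ) :
    nnz v = ∑ i, nnz (fun j => v (i, j)) := by
  classical
  simp only [nnz, Finset.card_filter, Fintype.sum_prod_type]

lemma nnz_smul_le {γ : Type} [Fintype γ] (c : ℝ) (v : γ → ℝ) :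
    nnz (fun i => c * v i) ≤ nnz v :=
  nnz_le_of_injective id Function.injective_id _ _ fun _ hi => right_ne_zero_of_mul hi

/-- Two networks side by side, with the outputs added. -/
def add (G : UniformNet d ι) (H : UniformNet d κ) : UniformNet d (ι ⊕ κ) where
  input := Sum.elim G.input H.input
  weight t := Sum.elim (fun i => Sum.elim (G.weight t i) fun _ => 0)
    (fun i => Sum.elim (fun _ => 0) (H.weight t i))
  bias t := Sum.elim (G.bias t) (H.bias t)
  coeff := Sum.elim G.coeff H.coeff

lemma state_add (G : UniformNet d ι) (H : UniformNet d κ) (x : Fin d → ℝ) (l : ℕ) :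
    (G.add H).state x l = Sum.elim (G.state x l) (H.state x l) := by
  induction l with
  | zero => ext (i | i) <;> simp [state, add]
  | succ l ih => ext (i | i) <;> simp [state, ih] <;> simp [add]

lemma eval_add (G : UniformNet d ι) (H : UniformNet d κ) (l : ℕ) (x : Fin d → ℝ) :
    (G.add H).eval l x = G.eval l x + H.eval l x := by
  simp only [eval, state_add, Fintype.sum_sum_type, Sum.elim_inl, Sum.elim_inr]
  simp [add]

lemma count_add (G : UniformNet d ι) (H : UniformNet d κ) (l : ℕ) :
    (G.add H).count l = G.count l + H.count l := by
  simp only [count, nnz_prod, nnz_sum, Fintype.sum_sum_type, add, Sum.elim_inl, Sum.elim_inr,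
    nnz_zero, Finset.sum_const_zero, Finset.sum_add_distrib]
  ring

/-- The network with the output multiplied by `c`. -/
def smul (c : ℝ) (G : UniformNet d ι) : UniformNet d ι :=
  { G with coeff := fun i => c * G.coeff i }

lemma state_smul (c : ℝ) (G : UniformNet d ι) (x : Fin d → ℝ) (l : ℕ) :
    (G.smul c).state x l = G.state x l := by
  induction l with
  | zero => rfl
  | succ l ih => simp only [state, ih]; rfl

lemma eval_smul (c : ℝ) (G : UniformNet d ι) (l : ℕ) (x : Fin d → ℝ) :
    (G.smul c).eval l x = c * G.eval l x := by
  simp only [eval, state_smul, Finset.mul_sum]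
  simp [smul, mul_assoc]

lemma count_smul_le (c : ℝ) (G : UniformNet d ι) (l : ℕ) :
    (G.smul c).count l ≤ G.count l := by
  have := nnz_smul_le c G.coeff
  simp only [count, smul]
  omega

lemma state_congr (G H : UniformNet d ι) (l : ℕ) (hi : G.input = H.input)
    (hw : ∀ t < l, G.weight t = H.weight t) (hb : ∀ t ≤ l, G.bias t = H.bias t)
    (x : Fin d → ℝ) : G.state x l = H.state x l := by
  induction l with
  | zero => simp only [state, hi, hb 0 le_rfl]
  | succ l ih =>
    have := ih (fun t ht => hw t (by omega)) (fun t ht => hb t (by omega))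
    simp only [state, this, hw l (by omega), hb (l + 1) le_rfl]

/-- The network that appends to layer `l + 1` a layer with one active unit, which holds the
output. -/
def extend (G : UniformNet d ι) (l : ℕ) : UniformNet d (ι ⊕ Unit) where
  input := Sum.elim G.input fun _ _ => 0
  weight t := if t < l then
      Sum.elim (fun i => Sum.elim (G.weight t i) fun _ => 0) (fun _ _ => 0)
    else Sum.elim (fun _ _ => 0) (fun _ => Sum.elim G.coeff fun _ => 0)
  bias t := if t ≤ l then Sum.elim (G.bias t) (fun _ => 0) else fun _ => 0
  coeff := Sum.elim (fun _ => 0) fun _ => 1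

lemma state_extend (G : UniformNet d ι) (l : ℕ) (x : Fin d → ℝ) :
    ∀ t ≤ l, ∀ i, (G.extend l).state x t (Sum.inl i) = G.state x t i
  | 0, _, i => by simp [state, extend]
  | t + 1, ht, i => by
    have ih := state_extend G l x t (by omega)
    simp only [state, Fintype.sum_sum_type, ih]
    simp [extend, ht, show t < l by omega]

lemma eval_extend (G : UniformNet d ι) (l : ℕ) (x : Fin d → ℝ) :
    (G.extend l).eval (l + 1) x = max (G.eval l x) 0 := by
  simp only [eval, Fintype.sum_sum_type, state, state_extend G l x l le_rfl]
  simp [extend]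

/-- The old output coefficients turn into the incoming weights of the new unit, so only the output
coefficient of that unit is additional. -/
lemma count_extend_le (G : UniformNet d ι) (l : ℕ) :
    (G.extend l).count (l + 1) ≤ G.count l + 1 := by
  have h0 : ∀ t < l, nnz (fun p : (ι ⊕ Unit) × (ι ⊕ Unit) => (G.extend l).weight t p.1 p.2)
      + nnz ((G.extend l).bias (t + 1)) =
      nnz (fun p : ι × ι => G.weight t p.1 p.2) + nnz (G.bias (t + 1)) := by
    intro t ht
    simp [extend, ht, show t + 1 ≤ l by omega, nnz_prod, nnz_sum, nnz_zero]
  have h1 : nnz (fun p : (ι ⊕ Unit) × (ι ⊕ Unit) => (G.extend l).weight l p.1 p.2)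
      + nnz ((G.extend l).bias (l + 1)) = nnz G.coeff := by
    simp [extend, nnz_prod, nnz_sum, nnz_zero]
  have h2 : nnz (G.extend l).coeff ≤ 1 := by
    have := nnz_le_card (fun _ : Unit => (1 : ℝ))
    simpa [extend, nnz_sum, nnz_zero] using this
  have h3 : nnz (fun p : (ι ⊕ Unit) × Fin d => (G.extend l).input p.1 p.2)
      + nnz ((G.extend l).bias 0) = nnz (fun p : ι × Fin d => G.input p.1 p.2)
      + nnz (G.bias 0) := by
    simp [extend, nnz_prod, nnz_sum, nnz_zero]
  unfold count
  rw [Finset.sum_range_succ, h1, h3, Finset.sum_congr rfl fun t ht => h0 t (Finset.mem_range.1 ht)]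
  omega

lemma count_le (G : UniformNet d ι) (l : ℕ) :
    G.count l ≤ Fintype.card ι * (d + 2) + l * (Fintype.card ι * (Fintype.card ι + 1)) := by
  have h1 := nnz_le_card G.coeff
  have h2 := nnz_le_card (fun p : ι × Fin d => G.input p.1 p.2)
  have h3 := nnz_le_card (G.bias 0)
  have h4 : ∑ t ∈ Finset.range l, (nnz (fun p : ι × ι => G.weight t p.1 p.2)
      + nnz (G.bias (t + 1))) ≤ l * (Fintype.card ι * (Fintype.card ι + 1)) := by
    calc _ ≤ ∑ t ∈ Finset.range l, (Fintype.card ι * (Fintype.card ι + 1)) := by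
          refine Finset.sum_le_sum fun t _ => ?_
          have h5 := nnz_le_card (fun p : ι × ι => G.weight t p.1 p.2)
          have h6 := nnz_le_card (G.bias (t + 1))
          rw [Fintype.card_prod] at h5
          nlinarith
      _ = _ := by simp
  rw [Fintype.card_prod, Fintype.card_fin] at h2
  unfold count
  nlinarith

/-- The network as a `Net` of constant width, the units being numbered by `e`. -/
def toNet {W : ℕ} (G : UniformNet d ι) (e : Fin W ≃ ι) (l : ℕ) : Net d (fun _ => W) (l + 1) where
  weight
    | 0 => fun i j => G.input (e i) j
    | t + 1 => fun i j => G.weight t (e i) (e j)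
  bias t := fun i => G.bias t (e i)
  coeff := fun i => G.coeff (e i)

lemma layer_toNet {W : ℕ} (G : UniformNet d ι) (e : Fin W ≃ ι) (l : ℕ) (x : Fin d → ℝ) :
    ∀ t, (G.toNet e l).layer x (t + 1) = fun i => G.state x t (e i)
  | 0 => by
    ext i
    simp [Net.layer, state, toNet, Matrix.mulVec, dotProduct]
    rfl
  | t + 1 => by
    ext i
    rw [Net.layer, layer_toNet G e l x t, state]
    simp only [toNet, Matrix.mulVec, dotProduct]
    congr 2
    exact Equiv.sum_comp e fun j => G.weight t (e i) j * G.state x t j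

lemma eval_toNet {W : ℕ} (G : UniformNet d ι) (e : Fin W ≃ ι) (l : ℕ) (x : Fin d → ℝ) :
    (G.toNet e l).eval x = G.eval l x := by
  rw [Net.eval, layer_toNet, eval]
  exact Equiv.sum_comp e fun j => G.coeff j * G.state x l j

lemma numNonzero_toNet_le {W : ℕ} (G : UniformNet d ι) (e : Fin W ≃ ι) (l : ℕ) :
    (G.toNet e l).numNonzero ≤ G.count l := by
  classical
  have key : ∀ {γ γ' : Type} [Fintype γ] [Fintype γ'] (g : γ → γ') (_ : Function.Injective g)
      (v : γ → ℝ) (v' : γ' → ℝ) (_ : ∀ i, v i = v' (g i)) (P : DecidablePred fun i => v i ≠ 0),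
      (Finset.univ.filter fun i => v i ≠ 0).card ≤ nnz v' := by
    intro γ γ' _ _ g hg v v' h P
    refine le_trans (le_of_eq ?_) (nnz_le_of_injective g hg v v' fun i hi => by rwa [← h i])
    rw [nnz]
    congr
  unfold Net.numNonzero count
  rw [Finset.sum_range_succ', add_assoc (nnz G.coeff), add_comm (∑ _ ∈ _, _)]
  refine Nat.add_le_add ?_ (Nat.add_le_add (Nat.add_le_add ?_ ?_)
    (Finset.sum_le_sum fun t _ => Nat.add_le_add ?_ ?_))
  · exact key e e.injective _ _ (fun _ => rfl) _
  · exact key (γ := Fin W × Fin d) (Prod.map e id) (e.injective.prodMap Function.injective_id)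
      _ (fun p : ι × Fin d => G.input p.1 p.2) (fun _ => rfl) _
  · exact key e e.injective _ _ (fun _ => rfl) _
  · exact key (γ := Fin W × Fin W) (Prod.map e e) (e.injective.prodMap e.injective)
      _ (fun p : ι × ι => G.weight t p.1 p.2) (fun _ => rfl) _
  · exact key e e.injective _ _ (fun _ => rfl) _

end UniformNet

/-! ### Calculus of functions computable within a depth, width and parameter budget. -/

/-- `f` is computed by a ReLU network with `l + 1` hidden layers, of width at most `W` and with at
most `S` non-zero parameters. -/
def Realizes (d l W S : ℕ) (f : (Fin d → ℝ) → ℝ) : Prop :=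
  ∃ (ι : Type) (_ : Fintype ι) (G : UniformNet d ι),
    Fintype.card ι ≤ W ∧ G.count l ≤ S ∧ ∀ x, G.eval l x = f x

namespace Realizes

variable {d l W W' S S' : ℕ} {f g : (Fin d → ℝ) → ℝ}

lemma mono (h : Realizes d l W S f) (hW : W ≤ W') (hS : S ≤ S') : Realizes d l W' S' f := by
  obtain ⟨ι, _, G, h1, h2, h3⟩ := h
  exact ⟨ι, _, G, h1.trans hW, h2.trans hS, h3⟩

lemma zero : Realizes d l 0 0 fun _ => 0 :=
  ⟨Empty, inferInstance, ⟨fun _ _ => 0, fun _ _ _ => 0, fun _ _ => 0, fun _ => 0⟩,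
    by simp, by simp [UniformNet.count, UniformNet.nnz], by simp [UniformNet.eval]⟩

lemma add (hf : Realizes d l W S f) (hg : Realizes d l W' S' g) :
    Realizes d l (W + W') (S + S') fun x => f x + g x := by
  obtain ⟨ι, _, G, h1, h2, h3⟩ := hf
  obtain ⟨κ, _, H, k1, k2, k3⟩ := hg
  refine ⟨ι ⊕ κ, inferInstance, G.add H, ?_, ?_, fun x => ?_⟩
  · rw [Fintype.card_sum]; omega
  · rw [UniformNet.count_add]; omega
  · rw [UniformNet.eval_add, h3, k3]

lemma smul (c : ℝ) (hf : Realizes d l W S f) : Realizes d l W S fun x => c * f x := by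
  obtain ⟨ι, _, G, h1, h2, h3⟩ := hf
  exact ⟨ι, _, G.smul c, h1, (G.count_smul_le c l).trans h2, fun x => by
    rw [UniformNet.eval_smul, h3]⟩

lemma sum {γ : Type*} (s : Finset γ) {f : γ → (Fin d → ℝ) → ℝ}
    (h : ∀ i ∈ s, Realizes d l W S (f i)) :
    Realizes d l (s.card * W) (s.card * S) fun x => ∑ i ∈ s, f i x := by
  classical
  induction s using Finset.induction_on with
  | empty => simpa using zero
  | insert a s ha ih =>
    have := (h a (by simp)).add (ih fun i hi => h i (by simp [hi]))
    simp only [Finset.sum_insert ha, Finset.card_insert_of_notMem ha]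
    exact this.mono (by ring_nf; rfl) (by ring_nf; rfl)

/-- The ReLU is the identity on non-negative values, so such a function passes through one more
layer in a single unit. This is how networks of different depths are aligned before they are added.
-/
lemma succ_of_nonneg (hf : Realizes d l W S f) (h0 : ∀ x, 0 ≤ f x) :
    Realizes d (l + 1) (W + 1) (S + 1) f := by
  obtain ⟨ι, _, G, h1, h2, h3⟩ := hf
  refine ⟨ι ⊕ Unit, inferInstance, G.extend l, ?_, ?_, fun x => ?_⟩
  · simpa using h1
  · exact (G.count_extend_le l).trans (by omega)
  · rw [UniformNet.eval_extend, h3, max_eq_left (h0 x)]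

lemma add_of_nonneg (hf : Realizes d l W S f) (h0 : ∀ x, 0 ≤ f x) (k : ℕ) :
    Realizes d (l + k) (W + k) (S + k) f := by
  induction k with
  | zero => exact hf
  | succ k ih => exact ih.succ_of_nonneg h0

lemma one (d l : ℕ) : Realizes d l (l + 1) (l + (d + 2)) fun _ => 1 := by
  have : Realizes d 0 1 (d + 2) fun _ => 1 := by
    refine ⟨Unit, inferInstance, ⟨fun _ _ => 0, fun _ _ _ => 0, fun _ _ => 1, fun _ => 1⟩,
      by simp, (UniformNet.count_le _ _).trans (by simp), ?_⟩
    simp [UniformNet.eval, UniformNet.state]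
  have h := this.add_of_nonneg (fun _ => zero_le_one) l
  rw [zero_add] at h
  exact h.mono (by omega) (by omega)

/-- A budget only bounds the width; units with all parameters zero fill it up to exactly `W` at no
cost in non-zero parameters. -/
lemma exists_net (hf : Realizes d l W S f) :
    ∃ N : Net d (fun _ => W) (l + 1), N.numNonzero ≤ S ∧ ∀ x, N.eval x = f x := by
  obtain ⟨ι, _, G, h1, h2, h3⟩ := hf
  let Z : UniformNet d (Fin (W - Fintype.card ι)) :=
    ⟨fun _ _ => 0, fun _ _ _ => 0, fun _ _ => 0, fun _ => 0⟩
  have hZ : Z.count l = 0 := by simp [UniformNet.count, Z, UniformNet.nnz]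
  have hcard : Fintype.card (ι ⊕ Fin (W - Fintype.card ι)) = W := by
    simp only [Fintype.card_sum, Fintype.card_fin]; omega
  let e := (Fintype.equivFinOfCardEq hcard).symm
  refine ⟨(G.add Z).toNet e l, ?_, fun x => ?_⟩
  · refine (UniformNet.numNonzero_toNet_le _ e l).trans ?_
    rw [UniformNet.count_add, hZ]; omega
  · rw [UniformNet.eval_toNet, UniformNet.eval_add, h3]
    simp [UniformNet.eval, Z]

end Realizes

/-! ### Approximate squares and products by tent maps -/

/-- The tent map on `[0,1]`, as a combination of two ReLU units. -/
noncomputable def tent (y : ℝ) : ℝ := 2 * max y 0 - 4 * max (y - 1 / 2) 0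

lemma tent_of_le {y : ℝ} (h0 : 0 ≤ y) (h : y ≤ 1 / 2) : tent y = 2 * y := by
  rw [tent, max_eq_left h0, max_eq_right (by linarith)]; ring

lemma tent_of_ge {y : ℝ} (h : 1 / 2 ≤ y) : tent y = 2 - 2 * y := by
  rw [tent, max_eq_left (by linarith), max_eq_left (by linarith)]; ring

lemma tent_mem {y : ℝ} (hy : y ∈ Set.Icc (0 : ℝ) 1) : tent y ∈ Set.Icc (0 : ℝ) 1 := by
  obtain ⟨h0, h1⟩ := hy
  rcases le_total y (1 / 2) with h | h
  · rw [tent_of_le h0 h]; constructor <;> linarith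
  · rw [tent_of_ge h]; constructor <;> linarith

lemma tent_sq {y : ℝ} (hy : y ∈ Set.Icc (0 : ℝ) 1) :
    y - y ^ 2 = (tent y + (tent y - tent y ^ 2)) / 4 := by
  obtain ⟨h0, h1⟩ := hy
  rcases le_total y (1 / 2) with h | h
  · rw [tent_of_le h0 h]; ring
  · rw [tent_of_ge h]; ring

lemma tent_iterate_mem {y : ℝ} (hy : y ∈ Set.Icc (0 : ℝ) 1) (k : ℕ) :
    tent^[k] y ∈ Set.Icc (0 : ℝ) 1 := by
  induction k with
  | zero => exact hy
  | succ k ih => rw [Function.iterate_succ_apply']; exact tent_mem ih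

/-- The sawtooth approximation of `y - y ^ 2`. -/
noncomputable def sawSum (k : ℕ) (y : ℝ) : ℝ :=
  ∑ i ∈ Finset.range k, tent^[i + 1] y / 4 ^ (i + 1)

lemma sawSum_succ (k : ℕ) (y : ℝ) :
    sawSum (k + 1) y = sawSum k y + tent^[k + 1] y / 4 ^ (k + 1) :=
  Finset.sum_range_succ _ _

/-- `tent_sq` expresses `y - y ^ 2` through the same function at `tent y`, divided by `4`; this is
its `k`-fold iteration, with an explicit remainder. -/
lemma sub_sq_eq_sawSum {y : ℝ} (hy : y ∈ Set.Icc (0 : ℝ) 1) (k : ℕ) :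
    y - y ^ 2 = sawSum k y + (tent^[k] y - (tent^[k] y) ^ 2) / 4 ^ k := by
  induction k with
  | zero => simp [sawSum]
  | succ k ih =>
    rw [ih, sawSum_succ, tent_sq (tent_iterate_mem hy k), Function.iterate_succ_apply']
    field_simp
    ring

lemma sawSum_nonneg {y : ℝ} (hy : y ∈ Set.Icc (0 : ℝ) 1) (k : ℕ) : 0 ≤ sawSum k y :=
  Finset.sum_nonneg fun i _ => div_nonneg (tent_iterate_mem hy _).1 (by positivity)

lemma sawSum_le {y : ℝ} (hy : y ∈ Set.Icc (0 : ℝ) 1) (k : ℕ) : sawSum k y ≤ y - y ^ 2 := by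
  rw [sub_sq_eq_sawSum hy k]
  obtain ⟨h0, h1⟩ := tent_iterate_mem hy k
  have : 0 ≤ (tent^[k] y - (tent^[k] y) ^ 2) / 4 ^ k := div_nonneg (by nlinarith) (by positivity)
  linarith

lemma le_sawSum {y : ℝ} (hy : y ∈ Set.Icc (0 : ℝ) 1) (k : ℕ) :
    y - y ^ 2 - 1 / 4 ^ k ≤ sawSum k y := by
  rw [sub_sq_eq_sawSum hy k]
  obtain ⟨h0, h1⟩ := tent_iterate_mem hy k
  have : (tent^[k] y - (tent^[k] y) ^ 2) / 4 ^ k ≤ 1 / 4 ^ k :=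
    div_le_div_of_nonneg_right (by nlinarith) (by positivity)
  linarith

/-- The approximate product of two numbers of `[0,1]`, from
`x y = ((x + y) / 2) ^ 2 + b - b ^ 2 - 1 / 4` with `b = (1 + x - y) / 2`. -/
noncomputable def approxMul (k : ℕ) (x y : ℝ) : ℝ :=
  max ((x + y) / 2 - sawSum k ((x + y) / 2) + sawSum k ((1 + x - y) / 2) - 1 / 4) 0

lemma half_add_mem {x y : ℝ} (hx : x ∈ Set.Icc (0 : ℝ) 1) (hy : y ∈ Set.Icc (0 : ℝ) 1) :
    (x + y) / 2 ∈ Set.Icc (0 : ℝ) 1 := by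
  obtain ⟨h0, h1⟩ := hx
  obtain ⟨h2, h3⟩ := hy
  constructor <;> linarith

lemma half_one_add_sub_mem {x y : ℝ} (hx : x ∈ Set.Icc (0 : ℝ) 1) (hy : y ∈ Set.Icc (0 : ℝ) 1) :
    (1 + x - y) / 2 ∈ Set.Icc (0 : ℝ) 1 := by
  obtain ⟨h0, h1⟩ := hx
  obtain ⟨h2, h3⟩ := hy
  constructor <;> linarith

/-- The term `b - b ^ 2` is at most `1 / 4`, which the subtracted `1 / 4` absorbs. Remaining in the
unit interval is what allows products to be chained. -/
lemma approxMul_mem {x y : ℝ} (hx : x ∈ Set.Icc (0 : ℝ) 1) (hy : y ∈ Set.Icc (0 : ℝ) 1) (k : ℕ) :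
    approxMul k x y ∈ Set.Icc (0 : ℝ) 1 := by
  refine ⟨le_max_right _ _, max_le ?_ zero_le_one⟩
  have h1 := sawSum_nonneg (half_add_mem hx hy) k
  have h2 := sawSum_le (half_one_add_sub_mem hx hy) k
  have h3 := (half_add_mem hx hy).2
  nlinarith [sq_nonneg ((1 + x - y) / 2 - 1 / 2)]

/-- Truncating the sawtooth sums overestimates `a ^ 2` and underestimates `b - b ^ 2`, so the two
errors have opposite signs and do not add up. The cut-off at `0` is harmless because `x * y ≥ 0`. -/
lemma abs_approxMul_sub_le {x y : ℝ} (hx : x ∈ Set.Icc (0 : ℝ) 1) (hy : y ∈ Set.Icc (0 : ℝ) 1)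
    (k : ℕ) : |approxMul k x y - x * y| ≤ 1 / 4 ^ k := by
  have h1 := sawSum_le (half_add_mem hx hy) k
  have h2 := sawSum_le (half_one_add_sub_mem hx hy) k
  have h3 := le_sawSum (half_add_mem hx hy) k
  have h4 := le_sawSum (half_one_add_sub_mem hx hy) k
  have h5 : 0 ≤ x * y := mul_nonneg hx.1 hy.1
  have h6 : (0 : ℝ) ≤ 1 / 4 ^ k := by positivity
  rw [approxMul, abs_le]
  constructor
  · have := le_max_left
      ((x + y) / 2 - sawSum k ((x + y) / 2) + sawSum k ((1 + x - y) / 2) - 1 / 4) 0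
    nlinarith
  · rw [sub_le_iff_le_add]
    refine max_le ?_ (by linarith)
    nlinarith

/-- The approximate product of a list of numbers. -/
noncomputable def approxProd (k : ℕ) : ℝ → List ℝ → ℝ := List.foldl (approxMul k)

lemma approxProd_spec (k : ℕ) (l : List ℝ) (hl : ∀ y ∈ l, y ∈ Set.Icc (0 : ℝ) 1) :
    ∀ x ∈ Set.Icc (0 : ℝ) 1, |approxProd k x l - x * l.prod| ≤ l.length * (1 / 4 ^ k) := by
  induction l with
  | nil => intro x _; simp [approxProd]
  | cons y l ih =>
    intro x hx
    have hy := hl y (by simp)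
    have hl' : ∀ z ∈ l, z ∈ Set.Icc (0 : ℝ) 1 := fun z hz => hl z (by simp [hz])
    have h1 := ih hl' _ (approxMul_mem hx hy k)
    have h2 := abs_approxMul_sub_le hx hy k
    have h3 : l.prod ∈ Set.Icc (0 : ℝ) 1 :=
      ⟨List.prod_nonneg fun z hz => (hl' z hz).1, by
        clear ih h1 hl
        induction l with
        | nil => simp
        | cons z l ih =>
          rw [List.prod_cons]
          have hz := hl' z (by simp)
          exact mul_le_one₀ hz.2
            (List.prod_nonneg fun z hz => (hl' z (by simp [hz])).1)
            (ih fun z hz => hl' z (by simp [hz]))⟩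
    -- The remaining factors are at most `1`, so an earlier error is not amplified and the errors
    -- only add.
    have h4 : |(approxMul k x y - x * y) * l.prod| ≤ 1 / 4 ^ k := by
      rw [abs_mul, abs_of_nonneg h3.1]
      exact (mul_le_of_le_one_right (abs_nonneg _) h3.2).trans h2
    have h5 : approxProd k x (y :: l) - x * (y :: l).prod =
        (approxProd k (approxMul k x y) l - approxMul k x y * l.prod) +
          (approxMul k x y - x * y) * l.prod := by
      simp only [approxProd, List.foldl_cons, List.prod_cons]; ring
    rw [h5]
    refine (abs_add_le _ _).trans ?_
    rw [List.length_cons]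
    push_cast
    linarith

/-! ### A network of bounded width that multiplies -/

variable {d : ℕ}

/-- `F` is the vector of activations of layer `l + 1` of some network. -/
def HasState (d : ℕ) {ι : Type} [Fintype ι] (l : ℕ) (F : (Fin d → ℝ) → ι → ℝ) : Prop :=
  ∃ G : UniformNet d ι, ∀ x, G.state x l = F x

lemma HasState.init {ι : Type} [Fintype ι] (A : ι → Fin d → ℝ) (b : ι → ℝ) :
    HasState d 0 fun x i => max (∑ j, A i j * x j + b i) 0 :=
  ⟨⟨A, fun _ _ _ => 0, fun _ => b, fun _ => 0⟩, fun _ => rfl⟩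

lemma HasState.step {ι : Type} [Fintype ι] {l : ℕ} {F : (Fin d → ℝ) → ι → ℝ}
    (h : HasState d l F) (A : ι → ι → ℝ) (b : ι → ℝ) :
    HasState d (l + 1) fun x i => max (∑ j, A i j * F x j + b i) 0 := by
  obtain ⟨G, hG⟩ := h
  let H : UniformNet d ι := ⟨G.input, Function.update G.weight l A,
    Function.update G.bias (l + 1) b, G.coeff⟩
  refine ⟨H, fun x => ?_⟩
  have : H.state x l = G.state x l := by
    refine UniformNet.state_congr H G l rfl (fun t ht => ?_) (fun t ht => ?_) x
    · exact Function.update_of_ne (by omega) _ _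
    · exact Function.update_of_ne (by omega) _ _
  ext i
  simp only [UniformNet.state, this, hG]
  simp [H]

lemma HasState.congr {ι : Type} [Fintype ι] {l : ℕ} {F F' : (Fin d → ℝ) → ι → ℝ}
    (h : HasState d l F) (hF : ∀ x, F x = F' x) : HasState d l F' := by
  obtain ⟨G, hG⟩ := h
  exact ⟨G, fun x => (hG x).trans (hF x)⟩

lemma HasState.realizes {ι : Type} [Fintype ι] {l : ℕ} {F : (Fin d → ℝ) → ι → ℝ}
    (h : HasState d l F) (i : ι) :
    Realizes d l (Fintype.card ι)
      (Fintype.card ι * (d + 2) + l * (Fintype.card ι * (Fintype.card ι + 1)))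
      fun x => F x i := by
  classical
  obtain ⟨G, hG⟩ := h
  let H : UniformNet d ι := { G with coeff := Pi.single i 1 }
  refine ⟨ι, _, H, le_rfl, UniformNet.count_le _ _, fun x => ?_⟩
  have : H.state x l = F x := by
    rw [← hG]
    exact UniformNet.state_congr H G l rfl (fun _ _ => rfl) (fun _ _ => rfl) x
  simp [UniformNet.eval, this, H, Pi.single_apply]

variable {J : Type} [Fintype J]

/-- The registers of the multiplication network: one factor for every `j : J`, and five work
registers. -/
def regs (r : J → ℝ) (w : Fin 5 → ℝ) : (J × Bool) ⊕ Fin 5 → ℝ :=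
  Sum.elim (fun p => if p.2 then r p.1 else 0) w

/-- The factors are non-negative, so the ReLU carries them along unchanged while the work registers
undergo an arbitrary affine update followed by the ReLU. -/
lemma HasState.step_regs {l : ℕ} {r : (Fin d → ℝ) → J → ℝ} {w : (Fin d → ℝ) → Fin 5 → ℝ}
    (h : HasState d l fun x => regs (r x) (w x)) (hr : ∀ x j, 0 ≤ r x j)
    (α : Fin 5 → J → ℝ) (β : Fin 5 → Fin 5 → ℝ) (γ : Fin 5 → ℝ) :
    HasState d (l + 1) fun x => regs (r x) fun c =>
      max (∑ j, α c j * r x j + ∑ e, β c e * w x e + γ c) 0 := by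
  classical
  refine (h.step
    (Sum.elim (fun p => Sum.elim (fun q => if p = q then 1 else 0) fun _ => 0)
      (fun c => Sum.elim (fun q => α c q.1) (β c)))
    (Sum.elim (fun _ => 0) γ)).congr fun x => ?_
  ext (⟨j, b⟩ | c)
  · have h2 : 0 ≤ (if b = true then r x j else 0) := by split_ifs <;> simp [hr]
    simp only [regs, Sum.elim_inl, Fintype.sum_sum_type, ite_mul, one_mul, zero_mul,
      Finset.sum_ite_eq, Finset.mem_univ, if_true, Sum.elim_inr, Finset.sum_const_zero, add_zero]
    exact max_eq_left h2
  · simp [regs, Fintype.sum_sum_type, Fintype.sum_prod_type]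

/-- The work registers during the approximate computation of `a ^ 2 + b - b ^ 2`. -/
noncomputable def sawRegs (k : ℕ) (a b : ℝ) : Fin 5 → ℝ :=
  ![max (tent^[k] a) 0, max (tent^[k] a - 1 / 2) 0, max (tent^[k] b) 0,
    max (tent^[k] b - 1 / 2) 0, a - sawSum k a + sawSum k b]

lemma HasState.sawRegs_zero {l : ℕ} {r : (Fin d → ℝ) → J → ℝ} {P : (Fin d → ℝ) → ℝ}
    (h : HasState d l fun x => regs (r x) ![0, 0, 0, 0, P x])
    (hr : ∀ x j, r x j ∈ Set.Icc (0 : ℝ) 1) (hP : ∀ x, P x ∈ Set.Icc (0 : ℝ) 1) (j : J) :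
    HasState d (l + 1) fun x => regs (r x)
      (sawRegs 0 ((P x + r x j) / 2) ((1 + P x - r x j) / 2)) := by
  classical
  -- The rows give `a`, `a - 1/2`, `b`, `b - 1/2` and again `a`, for `a = (P + r j) / 2` and `b = (1
  -- + P - r j) / 2`; the last register held `P` and now starts the accumulator.
  refine (h.step_regs (fun x j => (hr x j).1)
    (fun c i => if i = j then ![1 / 2, 1 / 2, -1 / 2, -1 / 2, 1 / 2] c else 0)
    (fun _ => ![0, 0, 0, 0, 1 / 2]) ![0, -1 / 2, 1 / 2, 0, 0]).congr fun x => ?_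
  congr 1
  have h1 := (half_add_mem (hP x) (hr x j)).1
  ext c
  simp only [ite_mul, zero_mul, Finset.sum_ite_eq', Finset.mem_univ, if_true, sawRegs,
    Function.iterate_zero, id]
  fin_cases c <;> simp [Fin.sum_univ_five, sawSum]
  · ring_nf
  · ring_nf
  · ring_nf
  · ring_nf
  · rw [← max_eq_left h1]; ring_nf

/-- The stored pair of ReLU values of an iterate yields the next iterate as `2 *` the first minus `4
*` the second, and hence also the next sawtooth term. The accumulator stays non-negative, so the
ReLU does not alter it. -/
lemma HasState.sawRegs_succ {l k : ℕ} {r : (Fin d → ℝ) → J → ℝ} {a b : (Fin d → ℝ) → ℝ}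
    (h : HasState d l fun x => regs (r x) (sawRegs k (a x) (b x)))
    (hr : ∀ x j, 0 ≤ r x j) (ha : ∀ x, a x ∈ Set.Icc (0 : ℝ) 1)
    (hb : ∀ x, b x ∈ Set.Icc (0 : ℝ) 1) :
    HasState d (l + 1) fun x => regs (r x) (sawRegs (k + 1) (a x) (b x)) := by
  refine (h.step_regs hr (fun _ _ => 0)
    ![![2, -4, 0, 0, 0], ![2, -4, 0, 0, 0], ![0, 0, 2, -4, 0], ![0, 0, 2, -4, 0],
      ![-2 / 4 ^ (k + 1), 4 / 4 ^ (k + 1), 2 / 4 ^ (k + 1), -4 / 4 ^ (k + 1), 1]]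
    ![0, -1 / 2, 0, -1 / 2, 0]).congr fun x => ?_
  congr 1
  have h1 : 0 ≤ a x - sawSum (k + 1) (a x) + sawSum (k + 1) (b x) := by
    have h2 := sawSum_le (ha x) (k + 1)
    have h3 := sawSum_nonneg (hb x) (k + 1)
    nlinarith [sq_nonneg (a x)]
  ext c
  simp only [sawRegs, zero_mul, Finset.sum_const_zero, Function.iterate_succ_apply']
  rw [sawSum_succ, sawSum_succ, Function.iterate_succ_apply', Function.iterate_succ_apply'] at *
  generalize tent^[k] (a x) = u at *
  generalize tent^[k] (b x) = v at *
  fin_cases c <;> simp [Fin.sum_univ_five, tent]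
  · ring_nf
  · ring_nf
  · ring_nf
  · ring_nf
  · simp only [tent, one_div] at h1
    rw [← max_eq_left h1]; ring_nf

lemma HasState.mul {l : ℕ} {r : (Fin d → ℝ) → J → ℝ} {P : (Fin d → ℝ) → ℝ}
    (h : HasState d l fun x => regs (r x) ![0, 0, 0, 0, P x])
    (hr : ∀ x j, r x j ∈ Set.Icc (0 : ℝ) 1) (hP : ∀ x, P x ∈ Set.Icc (0 : ℝ) 1) (k : ℕ) (j : J) :
    HasState d (l + (k + 2)) fun x => regs (r x) ![0, 0, 0, 0, approxMul k (P x) (r x j)] := by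
  have h1 : ∀ i, HasState d (l + 1 + i) fun x => regs (r x)
      (sawRegs i ((P x + r x j) / 2) ((1 + P x - r x j) / 2)) := by
    intro i
    induction i with
    | zero => exact h.sawRegs_zero hr hP j
    | succ i ih =>
      exact ih.sawRegs_succ (fun x j => (hr x j).1) (fun x => half_add_mem (hP x) (hr x j))
        (fun x => half_one_add_sub_mem (hP x) (hr x j))
  -- The last of the `k + 2` layers subtracts `1 / 4` and clears the other registers; its ReLU is
  -- the cut-off in `approxMul`.
  have h2 := (h1 k).step_regs (fun x j => (hr x j).1) (fun _ _ => 0)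
    ![0, 0, 0, 0, ![0, 0, 0, 0, 1]] ![0, 0, 0, 0, -1 / 4]
  rw [show l + 1 + k + 1 = l + (k + 2) by ring] at h2
  refine h2.congr fun x => ?_
  congr 1
  ext c
  fin_cases c <;> simp [Fin.sum_univ_five, sawRegs, approxMul]
  ring_nf

lemma HasState.prod {r : (Fin d → ℝ) → J → ℝ}
    (hr : ∀ x j, r x j ∈ Set.Icc (0 : ℝ) 1) (k : ℕ) (js : List J) :
    ∀ {l : ℕ} {P : (Fin d → ℝ) → ℝ}, (∀ x, P x ∈ Set.Icc (0 : ℝ) 1) →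
    HasState d l (fun x => regs (r x) ![0, 0, 0, 0, P x]) →
    HasState d (l + js.length * (k + 2)) fun x =>
      regs (r x) ![0, 0, 0, 0, approxProd k (P x) (js.map (r x))] := by
  induction js with
  | nil => intro l P _ h; simpa [approxProd] using h
  | cons j js ih =>
    intro l P hP h
    have := ih (fun x => approxMul_mem (hP x) (hr x j) k) (h.mul hr hP k j)
    rw [List.length_cons, show l + (js.length + 1) * (k + 2) =
      l + (k + 2) + js.length * (k + 2) by ring]
    exact this

/-- The factors `max (1 - |t|) 0` for affine functions `t`. -/
lemma HasState.factors (A : J → Fin d → ℝ) (b : J → ℝ) :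
    HasState d 1 fun x => regs (fun j => max (1 - |∑ i, A j i * x i + b j|) 0)
      ![0, 0, 0, 0, 1] := by
  classical
  -- The two units of a factor first hold the positive and negative parts of `t`. The next layer
  -- forms `1 - |t|` in the `true` unit; the `false` unit is idle from there on.
  refine ((HasState.init (d := d) (ι := (J × Bool) ⊕ Fin 5)
    (Sum.elim (fun p i => if p.2 then A p.1 i else - A p.1 i) fun _ _ => 0)
    (Sum.elim (fun p => if p.2 then b p.1 else - b p.1) fun _ => 0)).step
    (Sum.elim (fun p => Sum.elim (fun q => if p.2 then if p.1 = q.1 then -1 else 0 else 0)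
      fun _ => 0) fun _ _ => 0)
    (Sum.elim (fun p => if p.2 then 1 else 0) ![0, 0, 0, 0, 1])).congr fun x => ?_
  ext (⟨j, s⟩ | c)
  · cases s
    · simp [regs]
    · simp only [regs, Sum.elim_inl, if_true, Fintype.sum_sum_type, Fintype.sum_prod_type,
        Fintype.sum_bool, Sum.elim_inr, ite_mul, zero_mul, Finset.sum_add_distrib, Finset.sum_ite_eq,
        Finset.mem_univ, Bool.false_eq_true, if_false, Finset.sum_const_zero, add_zero,
        neg_mul, one_mul, Finset.sum_neg_distrib]
      congr 1
      rw [← neg_add, ← neg_add]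
      set t := ∑ i, A j i * x i + b j
      rcases le_total 0 t with ht | ht
      · rw [abs_of_nonneg ht, max_eq_left ht, max_eq_right (neg_nonpos.2 ht)]; ring
      · rw [abs_of_nonpos ht, max_eq_right ht, max_eq_left (neg_nonneg.2 ht)]; ring
  · fin_cases c <;> simp [regs]

lemma max_one_sub_abs_mem (t : ℝ) : max (1 - |t|) 0 ∈ Set.Icc (0 : ℝ) 1 :=
  ⟨le_max_right _ _, max_le (by linarith [abs_nonneg t]) zero_le_one⟩

/-- Products of functions `max (1 - |t|) 0` with affine `t` are approximated by networks of bounded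
width, with an error that decreases exponentially with the depth. -/
lemma exists_realizes_prod (A : J → Fin d → ℝ) (b : J → ℝ) (k : ℕ) :
    ∃ f : (Fin d → ℝ) → ℝ,
      Realizes d (1 + Fintype.card J * (k + 2)) (2 * Fintype.card J + 5)
        ((2 * Fintype.card J + 5) * (d + 2) + (1 + Fintype.card J * (k + 2)) *
          ((2 * Fintype.card J + 5) * (2 * Fintype.card J + 6))) f ∧
      ∀ x, |f x - ∏ j, max (1 - |∑ i, A j i * x i + b j|) 0| ≤
        Fintype.card J * (1 / 4 ^ k) := by
  have hr : ∀ (x : Fin d → ℝ) (j : J),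
      max (1 - |∑ i, A j i * x i + b j|) 0 ∈ Set.Icc (0 : ℝ) 1 :=
    fun x j => max_one_sub_abs_mem _
  have h := (HasState.prod hr k Finset.univ.toList (fun _ => ⟨zero_le_one, le_rfl⟩)
    (HasState.factors A b)).realizes (Sum.inr 4)
  have hc : Fintype.card ((J × Bool) ⊕ Fin 5) = 2 * Fintype.card J + 5 := by
    simp [Fintype.card_sum, Fintype.card_prod, mul_comm]
  have hc' : (Finset.univ : Finset J).toList.length = Fintype.card J := by
    simp [Finset.card_univ]
  rw [hc, hc'] at h
  refine ⟨_, h, fun x => ?_⟩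
  have h2 := approxProd_spec k (Finset.univ.toList.map fun j =>
    max (1 - |∑ i, A j i * x i + b j|) 0) (by
      intro y hy
      obtain ⟨j, _, rfl⟩ := List.mem_map.1 hy
      exact hr x j) 1 ⟨zero_le_one, le_rfl⟩
  rw [List.length_map, hc', Finset.prod_map_toList, one_mul] at h2
  exact h2

/-! ### Taylor polynomials on the cube -/

lemma uniqueDiffOn_cube (d : ℕ) : UniqueDiffOn ℝ (cube d) := by
  rw [cube, ← Set.pi_univ_Icc]
  exact UniqueDiffOn.univ_pi fun _ => uniqueDiffOn_Icc zero_lt_one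

lemma lineMap_mem_cube {a x : Fin d → ℝ} (ha : a ∈ cube d) (hx : x ∈ cube d) {t : ℝ}
    (ht : t ∈ Set.Icc (0 : ℝ) 1) : a + t • (x - a) ∈ cube d :=
  (convex_Icc (0 : Fin d → ℝ) 1).add_smul_sub_mem ha hx ht

lemma iteratedDerivWithin_line {F : (Fin d → ℝ) → ℝ} {p : ℕ} (hF : ContDiffOn ℝ p F (cube d))
    {a x : Fin d → ℝ} (ha : a ∈ cube d) (hx : x ∈ cube d) (k : ℕ) (hk : k ≤ p) :
    ∀ t ∈ Set.Icc (0 : ℝ) 1,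
      iteratedDerivWithin k (fun t : ℝ => F (a + t • (x - a))) (Set.Icc 0 1) t =
        iteratedFDerivWithin ℝ k F (cube d) (a + t • (x - a)) fun _ => x - a := by
  induction k with
  | zero => intro t _; simp
  | succ k ih =>
    intro t ht
    rw [iteratedDerivWithin_succ, derivWithin_congr (ih (by omega)) (ih (by omega) t ht)]
    have h1 := (hF.differentiableOn_iteratedFDerivWithin (m := k) (by exact_mod_cast hk)
      (uniqueDiffOn_cube d) _ (lineMap_mem_cube ha hx ht)).hasFDerivWithinAt
    have h2 : HasDerivWithinAt (fun t : ℝ => a + t • (x - a)) (x - a) (Set.Icc 0 1) t := by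
      simpa using (((hasDerivAt_id t).smul_const (x - a)).const_add a).hasDerivWithinAt
    have h3 := h1.comp_hasDerivWithinAt t h2 fun s hs => lineMap_mem_cube ha hx hs
    have h4 := ((ContinuousMultilinearMap.apply ℝ (fun _ : Fin k => Fin d → ℝ) ℝ
      fun _ => x - a).hasFDerivAt (x := iteratedFDerivWithin ℝ k F (cube d)
        (a + t • (x - a)))).comp_hasDerivWithinAt t h3
    exact h4.derivWithin (uniqueDiffOn_Icc zero_lt_one t ht)

/-- On the segment from `a` to `x`, the Lagrange remainder is a derivative of order `p` at an
intermediate point. Replacing that point by `a` completes the Taylor polynomial of degree `p`, and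
the Lipschitz condition supplies the additional factor `‖x - a‖`. -/
lemma abs_sub_taylor_le {F : (Fin d → ℝ) → ℝ} {p : ℕ} {K : ℝ} (hF : ContDiffOn ℝ p F (cube d))
    (hL : ∀ x ∈ cube d, ∀ y ∈ cube d,
      ‖iteratedFDerivWithin ℝ p F (cube d) x - iteratedFDerivWithin ℝ p F (cube d) y‖
        ≤ K * ‖x - y‖)
    {a x : Fin d → ℝ} (ha : a ∈ cube d) (hx : x ∈ cube d) :
    |F x - ∑ k ∈ Finset.range (p + 1), ((k.factorial : ℝ)⁻¹ *
      iteratedFDerivWithin ℝ k F (cube d) a fun _ => x - a)| ≤ K * ‖x - a‖ ^ (p + 1) := by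
  have key : ∀ t ∈ Set.Icc (0 : ℝ) 1,
      |iteratedFDerivWithin ℝ p F (cube d) (a + t • (x - a)) (fun _ => x - a) -
        iteratedFDerivWithin ℝ p F (cube d) a fun _ => x - a| ≤ K * ‖x - a‖ ^ (p + 1) := by
    intro t ht
    have h1 := hL _ (lineMap_mem_cube ha hx ht) a ha
    have hK : 0 ≤ K * ‖x - a‖ := (norm_nonneg _).trans (hL x hx a ha)
    have h2 : ‖a + t • (x - a) - a‖ = t * ‖x - a‖ := by
      rw [add_sub_cancel_left, norm_smul, Real.norm_of_nonneg ht.1]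
    rw [h2] at h1
    have h3 := (iteratedFDerivWithin ℝ p F (cube d) (a + t • (x - a)) -
      iteratedFDerivWithin ℝ p F (cube d) a).le_opNorm fun _ => x - a
    rw [sub_apply, Real.norm_eq_abs, Finset.prod_const, Finset.card_univ,
      Fintype.card_fin] at h3
    refine h3.trans ?_
    rw [pow_succ', ← mul_assoc]
    refine mul_le_mul_of_nonneg_right (h1.trans ?_) (by positivity)
    nlinarith [ht.2]
  -- For `p = 0` no Lagrange remainder is needed: the claim is the Lipschitz condition itself.
  rcases p with _ | q
  · have := key 1 (by simp)
    simpa using this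
  · have h01 : Set.uIcc (0 : ℝ) 1 = Set.Icc 0 1 := Set.uIcc_of_le zero_le_one
    have hg : ContDiffOn ℝ (q + 1 : ℕ) (fun t : ℝ => F (a + t • (x - a))) (Set.Icc 0 1) :=
      hF.comp (t := cube d) (by fun_prop) fun t ht => lineMap_mem_cube ha hx ht
    obtain ⟨t, ht, h⟩ := taylor_mean_remainder_lagrange (f := fun t : ℝ => F (a + t • (x - a)))
      (x₀ := 0) (x := 1) (n := q) zero_ne_one
      (by rw [h01]; exact hg.of_le (by exact_mod_cast q.le_succ))
      (by
        rw [h01, Set.uIoo_of_le zero_le_one]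
        exact (hg.differentiableOn_iteratedDerivWithin (by exact_mod_cast q.lt_succ_self)
          (uniqueDiffOn_Icc zero_lt_one)).mono Set.Ioo_subset_Icc_self)
    rw [Set.uIoo_of_le zero_le_one] at ht
    have ht' := Set.Ioo_subset_Icc_self ht
    have h0 : (0 : ℝ) ∈ Set.Icc (0 : ℝ) 1 := by simp
    rw [h01, iteratedDerivWithin_line hF ha hx (q + 1) le_rfl t ht', taylor_within_apply] at h
    have h5 : ∑ k ∈ Finset.range (q + 1), (((k.factorial : ℝ)⁻¹ * (1 - 0) ^ k) •
        iteratedDerivWithin k (fun t : ℝ => F (a + t • (x - a))) (Set.Icc 0 1) 0) =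
        ∑ k ∈ Finset.range (q + 1), ((k.factorial : ℝ)⁻¹ *
          iteratedFDerivWithin ℝ k F (cube d) a fun _ => x - a) := by
      refine Finset.sum_congr rfl fun k hk => ?_
      rw [iteratedDerivWithin_line hF ha hx k (by have := Finset.mem_range.1 hk; omega) 0 h0]
      simp
    rw [h5] at h
    simp only [one_smul, add_sub_cancel, sub_zero, one_pow, mul_one] at h
    rw [Finset.sum_range_succ, ← sub_sub, h, div_eq_inv_mul, ← mul_sub, abs_mul]
    have h6 : |((q + 1).factorial : ℝ)⁻¹| ≤ 1 := by
      rw [abs_of_nonneg (by positivity)]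
      exact inv_le_one_of_one_le₀ (by exact_mod_cast (q + 1).factorial_pos)
    exact (mul_le_of_le_one_left (abs_nonneg _) h6).trans (key t ht')

/-- The coordinates of `x`, together with the constant `1`. -/
def homCoord (x : Fin d → ℝ) (o : Option (Fin d)) : ℝ := o.elim 1 x

/-- Each `x i - a i` is linear in the coordinates extended by a constant `1`, with coefficients at
most `1` in absolute value on the cube. Padding with `m` factors `1` brings every Taylor term to the
common degree `k + m`, so that terms of all orders can be added coefficientwise. -/
lemma exists_coeff_multilinear {k m : ℕ}
    (D : ContinuousMultilinearMap ℝ (fun _ : Fin k => Fin d → ℝ) ℝ) {K : ℝ} (hD : ‖D‖ ≤ K)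
    {a : Fin d → ℝ} (ha : a ∈ cube d) :
    ∃ c : (Fin (k + m) → Option (Fin d)) → ℝ, (∀ q, |c q| ≤ d ^ k * K) ∧
      ∀ x, (D fun _ => x - a) = ∑ q, c q * ∏ j, homCoord x (q j) := by
  classical
  let lin : (Fin k → Fin d) → Fin (k + m) → Option (Fin d) → ℝ := fun r =>
    Fin.addCases (fun j o => o.elim (-a (r j)) fun i => if i = r j then 1 else 0)
      fun _ o => o.elim 1 fun _ => 0
  have hlin : ∀ r j o, |lin r j o| ≤ 1 := by
    intro r j o
    refine Fin.addCases (fun j => ?_) (fun j => ?_) j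
    · rcases o with _ | i
      · have h1 := ha.1 (r j)
        have h2 := ha.2 (r j)
        simp only [Pi.zero_apply, Pi.one_apply] at h1 h2
        simp [lin, abs_of_nonneg h1, h2]
      · simp only [lin, Fin.addCases_left, Option.elim_some]
        split_ifs <;> simp
    · rcases o with _ | i <;> simp [lin]
  let D' : (Fin k → Fin d) → ℝ := fun r => D fun j => Pi.single (r j) 1
  have hD' : ∀ r, |D' r| ≤ K := by
    intro r
    refine (D.le_opNorm _).trans (le_trans (mul_le_of_le_one_right (norm_nonneg _) ?_) hD)
    exact Finset.prod_le_one (fun _ _ => norm_nonneg _) fun j _ => by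
      rw [Pi.norm_single]; simp
  refine ⟨fun q => ∑ r, D' r * ∏ j, lin r j (q j), fun q => ?_, fun x => ?_⟩
  · refine (Finset.abs_sum_le_sum_abs _ _).trans ?_
    calc _ ≤ ∑ _r : Fin k → Fin d, K := by
          refine Finset.sum_le_sum fun r _ => ?_
          rw [abs_mul, Finset.abs_prod]
          exact (mul_le_of_le_one_right (abs_nonneg _)
            (Finset.prod_le_one (fun _ _ => abs_nonneg _) fun j _ => hlin r j _)).trans (hD' r)
      _ = _ := by simp
  · have h1 : (fun _ : Fin k => x - a) =
        fun _ : Fin k => ∑ i, (x i - a i) • (Pi.single i (1 : ℝ) : Fin d → ℝ) := by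
      funext _
      exact pi_eq_sum_univ' (x - a)
    rw [h1, D.map_sum]
    simp only [Finset.sum_mul]
    rw [Finset.sum_comm]
    refine Finset.sum_congr rfl fun r _ => ?_
    rw [D.map_smul_univ, smul_eq_mul, mul_comm]
    simp only [mul_assoc, ← Finset.mul_sum, ← Finset.prod_mul_distrib]
    congr 1
    rw [← Fintype.prod_sum (fun j o => lin r j o * homCoord x o), Fin.prod_univ_add]
    simp [lin, homCoord, Fintype.sum_option]
    refine Finset.prod_congr rfl fun j _ => by ring

/-- A function on the cube with bounded derivatives is approximated at every point by a polynomial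
with bounded coefficients. -/
lemma exists_coeff_taylor {F : (Fin d → ℝ) → ℝ} {p : ℕ} {K : ℝ}
    (hF : ContDiffOn ℝ p F (cube d))
    (hK : ∀ k ≤ p, ∀ x ∈ cube d, ‖iteratedFDerivWithin ℝ k F (cube d) x‖ ≤ K)
    (hL : ∀ x ∈ cube d, ∀ y ∈ cube d,
      ‖iteratedFDerivWithin ℝ p F (cube d) x - iteratedFDerivWithin ℝ p F (cube d) y‖
        ≤ K * ‖x - y‖)
    {a : Fin d → ℝ} (ha : a ∈ cube d) :
    ∃ c : (Fin p → Option (Fin d)) → ℝ,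
      (∀ q, |c q| ≤ (∑ k ∈ Finset.range (p + 1), (d : ℝ) ^ k) * K) ∧
      ∀ x ∈ cube d, |F x - ∑ q, c q * ∏ j, homCoord x (q j)| ≤ K * ‖x - a‖ ^ (p + 1) := by
  have h : ∀ k : ℕ, ∃ c : (Fin p → Option (Fin d)) → ℝ, k ≤ p → (∀ q, |c q| ≤ d ^ k * K) ∧
      ∀ x, (iteratedFDerivWithin ℝ k F (cube d) a fun _ => x - a) =
        ∑ q, c q * ∏ j, homCoord x (q j) := by
    intro k
    by_cases hk : k ≤ p
    · obtain ⟨m, rfl⟩ := Nat.exists_eq_add_of_le hk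
      obtain ⟨c, hc⟩ := exists_coeff_multilinear (m := m) _ (hK k hk a ha) ha
      exact ⟨c, fun _ => hc⟩
    · exact ⟨fun _ => 0, fun h => absurd h hk⟩
  choose c hc using h
  refine ⟨fun q => ∑ k ∈ Finset.range (p + 1), (k.factorial : ℝ)⁻¹ * c k q,
    fun q => ?_, fun x hx => ?_⟩
  · refine (Finset.abs_sum_le_sum_abs _ _).trans ?_
    rw [Finset.sum_mul]
    refine Finset.sum_le_sum fun k hk => ?_
    have h1 := (hc k (by have := Finset.mem_range.1 hk; omega)).1 q
    rw [abs_mul, abs_of_nonneg (by positivity : (0 : ℝ) ≤ (k.factorial : ℝ)⁻¹)]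
    exact (mul_le_of_le_one_left (abs_nonneg _)
      (inv_le_one_of_one_le₀ (by exact_mod_cast k.factorial_pos))).trans h1
  · have h1 := abs_sub_taylor_le hF hL ha hx
    have h2 : ∑ k ∈ Finset.range (p + 1), ((k.factorial : ℝ)⁻¹ *
        iteratedFDerivWithin ℝ k F (cube d) a fun _ => x - a) =
        ∑ q, (∑ k ∈ Finset.range (p + 1), (k.factorial : ℝ)⁻¹ * c k q) *
          ∏ j, homCoord x (q j) := by
      simp only [Finset.sum_mul]
      rw [Finset.sum_comm]
      refine Finset.sum_congr rfl fun k hk => ?_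
      rw [(hc k (by have := Finset.mem_range.1 hk; omega)).2 x, Finset.mul_sum]
      simp only [mul_assoc]
    rwa [h2] at h1

lemma norm_iteratedFDerivWithin_le_of_holderNorm {α : ℕ} {F : (Fin d → ℝ) → ℝ} {K : ℝ≥0}
    (h : holderNorm d α F ≤ K) {k : ℕ} (hk : k < α) {x : Fin d → ℝ} (hx : x ∈ cube d) :
    ‖iteratedFDerivWithin ℝ k F (cube d) x‖ ≤ K := by
  have h1 : ‖iteratedFDerivWithin ℝ k F (cube d) x‖ₑ ≤ K := by
    refine le_trans ?_ (le_trans (le_self_add.trans le_rfl) h)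
    refine le_trans ?_ (Finset.single_le_sum
      (f := fun k => ⨆ x ∈ cube d, ‖iteratedFDerivWithin ℝ k F (cube d) x‖ₑ)
      (fun _ _ => zero_le) (Finset.mem_range.2 hk))
    exact le_iSup₂ (f := fun x _ => ‖iteratedFDerivWithin ℝ k F (cube d) x‖ₑ) x hx
  rw [enorm_eq_nnnorm] at h1
  exact_mod_cast h1

lemma norm_iteratedFDerivWithin_sub_le_of_holderNorm {α : ℕ} {F : (Fin d → ℝ) → ℝ} {K : ℝ≥0}
    (h : holderNorm d α F ≤ K) {x y : Fin d → ℝ} (hx : x ∈ cube d) (hy : y ∈ cube d) :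
    ‖iteratedFDerivWithin ℝ (α - 1) F (cube d) x - iteratedFDerivWithin ℝ (α - 1) F (cube d) y‖
      ≤ K * ‖x - y‖ := by
  rcases eq_or_ne x y with rfl | hxy
  · simp
  have h1 : edist (iteratedFDerivWithin ℝ (α - 1) F (cube d) x)
      (iteratedFDerivWithin ℝ (α - 1) F (cube d) y) / edist x y ≤ K := by
    refine le_trans ?_ (le_trans le_add_self h)
    exact le_iSup₂_of_le x hx (le_iSup₂_of_le y hy (le_iSup_of_le hxy le_rfl))
  rw [ENNReal.div_le_iff (by simpa using hxy) (edist_ne_top x y), edist_nndist, edist_nndist] at h1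
  have h2 : nndist (iteratedFDerivWithin ℝ (α - 1) F (cube d) x)
      (iteratedFDerivWithin ℝ (α - 1) F (cube d) y) ≤ K * nndist x y := by exact_mod_cast h1
  rw [← dist_eq_norm, ← dist_eq_norm]
  exact_mod_cast h2

/-! ### Approximation of smooth functions by ReLU networks -/

/-- On `t ≥ 0` the partial sums are trapezoids: constant `1` up to `N`, then falling linearly to `0`
at `N + 1`. -/
lemma sum_hat_of_nonneg (N : ℕ) {t : ℝ} (ht : 0 ≤ t) :
    ∑ m ∈ Finset.range (N + 1), max (1 - |t - m|) 0 = min 1 (max (N + 1 - t) 0) := by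
  induction N with
  | zero =>
    simp only [zero_add, Finset.sum_range_one, Nat.cast_zero, sub_zero, abs_of_nonneg ht]
    exact (min_eq_right (max_le (by linarith) zero_le_one)).symm
  | succ N ih =>
    rw [Finset.sum_range_succ, ih]
    push_cast
    rcases abs_cases (t - (N + 1)) with ⟨h1, h2⟩ | ⟨h1, h2⟩ <;> rw [h1] <;>
      simp only [min_def, max_def] <;> split_ifs <;> linarith

lemma sum_hat_eq_one (N : ℕ) {t : ℝ} (h0 : 0 ≤ t) (h1 : t ≤ N) :
    ∑ m : Fin (N + 1), max (1 - |t - (m : ℕ)|) 0 = 1 := by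
  rw [Fin.sum_univ_eq_sum_range fun m => max (1 - |t - (m : ℝ)|) 0, sum_hat_of_nonneg N h0]
  exact min_eq_left ((by linarith : (1 : ℝ) ≤ N + 1 - t).trans (le_max_left _ _))

/-- The piecewise multilinear partition of unity subordinate to the grid of mesh `1 / N`. -/
noncomputable def gridHat (N : ℕ) (m : Fin d → Fin (N + 1)) (x : Fin d → ℝ) : ℝ :=
  ∏ i, max (1 - |N * x i - (m i : ℕ)|) 0

lemma gridHat_nonneg (N : ℕ) (m : Fin d → Fin (N + 1)) (x : Fin d → ℝ) : 0 ≤ gridHat N m x :=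
  Finset.prod_nonneg fun _ _ => le_max_right _ _

lemma sum_gridHat (N : ℕ) {x : Fin d → ℝ} (hx : x ∈ cube d) :
    ∑ m : Fin d → Fin (N + 1), gridHat N m x = 1 := by
  classical
  simp only [gridHat]
  rw [← Fintype.prod_sum fun i (m : Fin (N + 1)) => max (1 - |N * x i - (m : ℕ)|) 0]
  refine Finset.prod_eq_one fun i _ => sum_hat_eq_one N ?_ ?_
  · exact mul_nonneg N.cast_nonneg (hx.1 i)
  · exact mul_le_of_le_one_right N.cast_nonneg (hx.2 i)

lemma norm_sub_le_of_gridHat_ne_zero {N : ℕ} (hN : 1 ≤ N) {m : Fin d → Fin (N + 1)}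
    {x : Fin d → ℝ} (h : gridHat N m x ≠ 0) : ‖x - fun i => ((m i : ℕ) : ℝ) / N‖ ≤ 1 / N := by
  have hN' : (0 : ℝ) < N := by exact_mod_cast hN
  refine (pi_norm_le_iff_of_nonneg (by positivity)).2 fun i => ?_
  have h1 := Finset.prod_ne_zero_iff.1 h i (Finset.mem_univ i)
  have h2 : |N * x i - (m i : ℕ)| ≤ 1 := by
    by_contra! h3
    exact h1 (max_eq_right (by linarith))
  rw [Pi.sub_apply, Real.norm_eq_abs, le_div_iff₀ hN', ← abs_of_pos hN', ← abs_mul,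
    abs_of_pos hN', sub_mul, div_mul_cancel₀ _ hN'.ne', mul_comm]
  exact h2

/-- The partition of unity averages the local polynomials, so their error is that at distance `1 /
N`. Each product of a grid hat and a monomial is then replaced by its network approximation; the
second error term is the number of products times their weighted error. -/
lemma exists_realizes_grid {F : (Fin d → ℝ) → ℝ} {p : ℕ} {K B : ℝ}
    {N : ℕ} (hN : 1 ≤ N)
    (hF : ∀ a ∈ cube d, ∃ c : (Fin p → Option (Fin d)) → ℝ, (∀ q, |c q| ≤ B) ∧
      ∀ x ∈ cube d, |F x - ∑ q, c q * ∏ j, homCoord x (q j)| ≤ K * ‖x - a‖ ^ (p + 1)) (hK : 0 ≤ K)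
    (k : ℕ) :
    ∃ f : (Fin d → ℝ) → ℝ,
      Realizes d (1 + (d + p) * (k + 2)) (((N + 1) ^ d * (d + 1) ^ p) * (2 * (d + p) + 5))
        (((N + 1) ^ d * (d + 1) ^ p) * ((2 * (d + p) + 5) * (d + 2) + (1 + (d + p) * (k + 2)) *
          ((2 * (d + p) + 5) * (2 * (d + p) + 6)))) f ∧
      ∀ x ∈ cube d, |F x - f x| ≤
        K / N ^ (p + 1) + (N + 1) ^ d * (d + 1) ^ p * (B * ((d + p) * (1 / 4 ^ k))) := by
  classical
  have hN' : (0 : ℝ) < N := by exact_mod_cast hN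
  have hgrid : ∀ m : Fin d → Fin (N + 1), (fun i => ((m i : ℕ) : ℝ) / N) ∈ cube d := by
    intro m
    refine ⟨fun i => by simp only [Pi.zero_apply]; positivity, fun i => ?_⟩
    simp only [Pi.one_apply]
    rw [div_le_one hN']
    exact_mod_cast Nat.lt_succ_iff.1 (m i).2
  choose c hcB hc using fun m : Fin d → Fin (N + 1) => hF _ (hgrid m)
  let Q := (Fin d → Fin (N + 1)) × (Fin p → Option (Fin d))
  have hQ : Fintype.card Q = (N + 1) ^ d * (d + 1) ^ p := by
    simp [Q, Fintype.card_prod]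
  -- On the cube a coordinate also has the form `max (1 - |t|) 0`, with `t = 1 - x i`, and the
  -- constant `1` has it with `t = 0`. So each product consists of `d + p` factors of one kind.
  let A : Q → Fin d ⊕ Fin p → Fin d → ℝ := fun s => Sum.elim
    (fun i i' => if i' = i then N else 0)
    (fun j i' => if s.2 j = some i' then -1 else 0)
  let b : Q → Fin d ⊕ Fin p → ℝ := fun s => Sum.elim (fun i => -((s.1 i : ℕ) : ℝ))
    (fun j => (s.2 j).elim 0 fun _ => 1)
  have hprod : ∀ s : Q, ∀ x ∈ cube d, ∏ j, max (1 - |∑ i, A s j i * x i + b s j|) 0 =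
      gridHat N s.1 x * ∏ j, homCoord x (s.2 j) := by
    intro s x hx
    rw [Fintype.prod_sum_type]
    congr 1
    · simp [gridHat, A, b, sub_eq_add_neg]
    · refine Finset.prod_congr rfl fun j _ => ?_
      rcases hq : s.2 j with _ | i
      · simp [A, b, homCoord, hq]
      · have h1 := hx.1 i
        have h2 := hx.2 i
        simp only [Pi.zero_apply, Pi.one_apply] at h1 h2
        simp only [A, b, homCoord, hq, Sum.elim_inr, Option.some.injEq, ite_mul, zero_mul,
          Finset.sum_ite_eq, Finset.mem_univ, if_true, Option.elim_some]
        rw [abs_of_nonneg (by linarith), max_eq_left (by linarith)]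
        ring
  choose z hz hzerr using fun s => exists_realizes_prod (A s) (b s) k
  refine ⟨fun x => ∑ s : Q, c s.1 s.2 * z s x, ?_, fun x hx => ?_⟩
  · have := Realizes.sum (Finset.univ : Finset Q) (f := fun s x => c s.1 s.2 * z s x)
      fun s _ => (hz s).smul _
    rw [Finset.card_univ, hQ] at this
    simpa using this
  · have e1 : F x - ∑ s : Q, c s.1 s.2 * z s x =
        ∑ m, gridHat N m x * (F x - ∑ q, c m q * ∏ j, homCoord x (q j)) -
        ∑ s : Q, c s.1 s.2 * (z s x - ∏ j, max (1 - |∑ i, A s j i * x i + b s j|) 0) := by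
      have e2 : F x = ∑ m, gridHat N m x * F x := by
        rw [← Finset.sum_mul, sum_gridHat N hx, one_mul]
      have e3 : ∑ s : Q, c s.1 s.2 * ∏ j, max (1 - |∑ i, A s j i * x i + b s j|) 0 =
          ∑ m, gridHat N m x * ∑ q, c m q * ∏ j, homCoord x (q j) := by
        rw [Fintype.sum_prod_type]
        refine Finset.sum_congr rfl fun m _ => ?_
        rw [Finset.mul_sum]
        refine Finset.sum_congr rfl fun q _ => ?_
        rw [hprod (m, q) x hx]
        ring
      simp only [mul_sub, Finset.sum_sub_distrib]
      rw [e3, ← e2]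
      ring
    rw [e1]
    refine (abs_sub _ _).trans (add_le_add ?_ ?_)
    · refine (Finset.abs_sum_le_sum_abs _ _).trans ?_
      calc _ ≤ ∑ m : Fin d → Fin (N + 1), gridHat N m x * (K / N ^ (p + 1)) := by
            refine Finset.sum_le_sum fun m _ => ?_
            rw [abs_mul, abs_of_nonneg (gridHat_nonneg N m x)]
            by_cases h0 : gridHat N m x = 0
            · simp [h0]
            · refine mul_le_mul_of_nonneg_left ((hc m x hx).trans ?_) (gridHat_nonneg N m x)
              rw [div_eq_mul_one_div, ← one_div_pow]
              exact mul_le_mul_of_nonneg_left (pow_le_pow_left₀ (norm_nonneg _)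
                (norm_sub_le_of_gridHat_ne_zero hN h0) _) hK
        _ = _ := by rw [← Finset.sum_mul, sum_gridHat N hx, one_mul]
    · refine (Finset.abs_sum_le_sum_abs _ _).trans ?_
      calc _ ≤ ∑ s : Q, B * ((d + p) * (1 / 4 ^ k)) := by
            refine Finset.sum_le_sum fun s _ => ?_
            rw [abs_mul]
            have h1 := hzerr s x
            rw [Fintype.card_sum, Fintype.card_fin, Fintype.card_fin] at h1
            push_cast at h1
            exact mul_le_mul (hcB _ _) h1 (abs_nonneg _) ((abs_nonneg _).trans (hcB s.1 s.2))
        _ = _ := by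
            rw [Finset.sum_const, Finset.card_univ, hQ, nsmul_eq_mul]
            push_cast
            ring

set_option maxHeartbeats 1000000 in
/-- Every function of the ball of radius `K` of `W^α_∞` is approximated up to `ζ` by networks
with depth of order `log (1 / ζ)` and of the order of `ζ ^ (-d / α) * log (1 / ζ)` parameters. -/
lemma exists_realizes_holder (d α : ℕ) (hα : 1 ≤ α) (K : ℝ≥0) :
    ∃ C : ℝ, 0 < C ∧ ∀ ζ : ℝ, 0 < ζ → ζ < 1 / 2 → ∃ l W S : ℕ,
      1 ≤ l ∧ (l : ℝ) ≤ C * Real.log (1 / ζ) ∧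
      (W : ℝ) ≤ C * (ζ ^ (-((d : ℝ) / α)) * Real.log (1 / ζ)) ∧
      (S : ℝ) ≤ C * (ζ ^ (-((d : ℝ) / α)) * Real.log (1 / ζ)) ∧
      ∀ F : (Fin d → ℝ) → ℝ, ContDiffOn ℝ ((α - 1 : ℕ) : WithTop ℕ∞) F (cube d) →
        holderNorm d α F ≤ K →
        ∃ f, Realizes d l W S f ∧ ∀ x ∈ cube d, |F x - f x| ≤ ζ := by
  obtain ⟨p, rfl⟩ : ∃ p, α = p + 1 := ⟨α - 1, by omega⟩
  set B : ℝ := (∑ k ∈ Finset.range (p + 1), (d : ℝ) ^ k) * K with hB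
  have hB0 : 0 ≤ B := by positivity
  set β : ℝ := (d : ℝ) / (p + 1 : ℕ) with hβ
  have hβ0 : 0 ≤ β := by positivity
  -- The mesh will be `1 / N` with `N` about `(κ / ζ) ^ (1 / α)`; this `κ` makes the Taylor error at
  -- most `ζ / 2`.
  set κ : ℝ := 2 * ((K : ℝ) + 1) with hκ
  have hκ1 : 1 ≤ κ := by have := K.coe_nonneg; rw [hκ]; linarith
  set C₁ : ℝ := 3 ^ d * κ ^ β with hC₁
  have hC₁0 : 0 < C₁ := by positivity
  set C₂ : ℝ := 2 * (C₁ * (d + 1) ^ p * (B * (d + p))) + 1 with hC₂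
  have hC₂1 : 1 ≤ C₂ := by
    have : 0 ≤ 2 * (C₁ * (d + 1) ^ p * (B * (d + p))) := by positivity
    linarith
  set C₃ : ℝ := 2 * Real.log C₂ + (β + 1) + 2 with hC₃
  have hC₃0 : 0 < C₃ := by have := Real.log_nonneg hC₂1; positivity
  set C₄ : ℝ := 2 + (d + p) * (C₃ + 4) with hC₄
  have hC₄0 : 0 < C₄ := by positivity
  set W₀ : ℝ := 2 * (d + p) + 5 with hW₀
  set C₅ : ℝ := C₁ * (d + 1) ^ p * (2 * W₀) with hC₅
  have hC₅0 : 0 < C₅ := by positivity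
  set C₆ : ℝ := C₁ * (d + 1) ^ p * (2 * (W₀ * (d + 2)) + C₄ * (W₀ * (W₀ + 1))) with hC₆
  have hC₆0 : 0 < C₆ := by positivity
  refine ⟨C₄ + C₅ + C₆, by positivity, fun ζ hζ hζ2 => ?_⟩
  set lam := Real.log (1 / ζ) with hlam
  -- As `ζ < 1/2`, the logarithm is bounded below, so additive constants can be absorbed into
  -- multiples of it.
  have hlam1 : 1 ≤ 2 * lam := by
    have h1 : Real.log 2 ≤ lam := Real.log_le_log (by norm_num) (by
      rw [le_div_iff₀ hζ]; linarith)
    have := Real.log_two_gt_d9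
    linarith
  have hlam0 : 0 < lam := by linarith
  set Z := ζ ^ (-β) with hZ
  have hZ0 : 0 < Z := by positivity
  set Y : ℝ := (κ / ζ) ^ ((1 : ℝ) / (p + 1 : ℕ)) with hY
  have hκζ : 1 ≤ κ / ζ := by rw [le_div_iff₀ hζ]; linarith
  have hY1 : 1 ≤ Y := Real.one_le_rpow hκζ (by positivity)
  have hYpow : Y ^ (p + 1) = κ / ζ := by
    rw [hY, ← Real.rpow_natCast, ← Real.rpow_mul (by positivity), one_div_mul_cancel
      (by positivity), Real.rpow_one]
  have hYd : Y ^ d = κ ^ β * Z := by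
    rw [hY, ← Real.rpow_natCast, ← Real.rpow_mul (by positivity), hZ, Real.rpow_neg hζ.le,
      Real.div_rpow (by positivity) hζ.le, hβ, div_eq_mul_inv, one_div_mul_eq_div]
  set N := ⌈Y⌉₊ with hNdef
  have hN1 : 1 ≤ N := Nat.one_le_ceil_iff.2 (by linarith)
  have hYN : Y ≤ N := Nat.le_ceil _
  have hNY : (N : ℝ) + 1 ≤ 3 * Y := by
    have := Nat.ceil_lt_add_one (a := Y) (by linarith)
    linarith
  have hNd : ((N : ℝ) + 1) ^ d ≤ C₁ * Z := by
    calc ((N : ℝ) + 1) ^ d ≤ (3 * Y) ^ d := pow_le_pow_left₀ (by positivity) hNY _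
      _ = C₁ * Z := by rw [mul_pow, hYd, hC₁]; ring
  -- Of order `log (1 / ζ)`, yet large enough for all product errors together to stay below `ζ / 2`.
  set k := ⌈Real.log (C₂ * (Z / ζ))⌉₊ with hk
  have hZζ : Real.log (Z / ζ) = (β + 1) * lam := by
    rw [Real.log_div hZ0.ne' hζ.ne', hZ, Real.log_rpow hζ, hlam, one_div, Real.log_inv]
    ring
  have hlogC : Real.log (C₂ * (Z / ζ)) = Real.log C₂ + (β + 1) * lam := by
    rw [Real.log_mul (by linarith) (by positivity), hZζ]
  have hkle : (k : ℝ) ≤ C₃ * lam := by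
    have h1 : 0 ≤ Real.log (C₂ * (Z / ζ)) := by
      rw [hlogC]
      have := Real.log_nonneg hC₂1
      positivity
    have h2 := Nat.ceil_lt_add_one h1
    rw [hlogC] at h2
    have h3 : Real.log C₂ ≤ Real.log C₂ * (2 * lam) :=
      le_mul_of_one_le_right (Real.log_nonneg hC₂1) hlam1
    have h4 : C₃ * lam = Real.log C₂ * (2 * lam) + (β + 1) * lam + 2 * lam := by rw [hC₃]; ring
    rw [hk, hlogC, h4]
    linarith
  have h4k : C₂ * (Z / ζ) ≤ 4 ^ k := by
    have h1 : Real.log (C₂ * (Z / ζ)) ≤ k := Nat.le_ceil _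
    rw [Real.log_le_iff_le_exp (by positivity)] at h1
    refine h1.trans ?_
    rw [← Real.exp_one_pow]
    exact pow_le_pow_left₀ (Real.exp_pos _).le (by have := Real.exp_one_lt_d9; linarith) _
  have hl : ((1 + (d + p) * (k + 2) : ℕ) : ℝ) ≤ C₄ * lam := by
    push_cast
    have h1 : ((d : ℝ) + p) * (k + 2) ≤ (d + p) * ((C₃ + 4) * lam) :=
      mul_le_mul_of_nonneg_left (by linarith) (by positivity)
    have h2 : C₄ * lam = 2 * lam + (d + p) * ((C₃ + 4) * lam) := by rw [hC₄]; ring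
    linarith
  have hM : (((N + 1) ^ d * (d + 1) ^ p : ℕ) : ℝ) ≤ C₁ * (d + 1) ^ p * Z := by
    push_cast
    calc ((N : ℝ) + 1) ^ d * (d + 1) ^ p ≤ C₁ * Z * (d + 1) ^ p :=
          mul_le_mul_of_nonneg_right hNd (by positivity)
      _ = _ := by ring
  refine ⟨1 + (d + p) * (k + 2), ((N + 1) ^ d * (d + 1) ^ p) * (2 * (d + p) + 5),
    ((N + 1) ^ d * (d + 1) ^ p) * ((2 * (d + p) + 5) * (d + 2) + (1 + (d + p) * (k + 2)) *
          ((2 * (d + p) + 5) * (2 * (d + p) + 6))), by omega, ?_, ?_, ?_, fun F hF hFK => ?_⟩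
  · refine hl.trans (mul_le_mul_of_nonneg_right ?_ hlam0.le)
    linarith
  · have h1 : ((((N + 1) ^ d * (d + 1) ^ p) * (2 * (d + p) + 5) : ℕ) : ℝ) ≤
        (C₁ * (d + 1) ^ p * Z) * (W₀ * (2 * lam)) := by
      rw [Nat.cast_mul]
      refine mul_le_mul hM ?_ (by positivity) (by positivity)
      push_cast
      exact le_mul_of_one_le_right (by positivity) hlam1
    refine h1.trans ?_
    calc (C₁ * (d + 1) ^ p * Z) * (W₀ * (2 * lam)) = C₅ * (Z * lam) := by rw [hC₅]; ring
      _ ≤ _ := mul_le_mul_of_nonneg_right (by linarith) (by positivity)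
  · have h1 : ((((N + 1) ^ d * (d + 1) ^ p) * ((2 * (d + p) + 5) * (d + 2) +
        (1 + (d + p) * (k + 2)) * ((2 * (d + p) + 5) * (2 * (d + p) + 6))) : ℕ) : ℝ) ≤
        (C₁ * (d + 1) ^ p * Z) * ((2 * (W₀ * (d + 2)) + C₄ * (W₀ * (W₀ + 1))) * lam) := by
      rw [Nat.cast_mul]
      refine mul_le_mul hM ?_ (by positivity) (by positivity)
      rw [Nat.cast_add, Nat.cast_mul (1 + (d + p) * (k + 2)), add_mul _ _ lam]
      refine add_le_add ?_ ?_
      · push_cast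
        have h3 : W₀ * (d + 2) * 1 ≤ W₀ * (d + 2) * (2 * lam) :=
          mul_le_mul_of_nonneg_left hlam1 (by positivity)
        linarith
      · have h2 : (((2 * (d + p) + 5) * (2 * (d + p) + 6) : ℕ) : ℝ) = W₀ * (W₀ + 1) := by
          push_cast; rw [hW₀]; ring
        rw [h2]
        calc _ ≤ C₄ * lam * (W₀ * (W₀ + 1)) := mul_le_mul_of_nonneg_right hl (by positivity)
          _ = _ := by ring
    refine h1.trans ?_
    calc _ = C₆ * (Z * lam) := by rw [hC₆]; ring
      _ ≤ _ := mul_le_mul_of_nonneg_right (by linarith) (by positivity)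
  · rw [Nat.add_sub_cancel] at hF
    obtain ⟨f, hf, hfe⟩ := exists_realizes_grid (B := B) (K := K) hN1 (fun a ha =>
      exists_coeff_taylor hF
        (fun k hk x hx => norm_iteratedFDerivWithin_le_of_holderNorm hFK (by omega) hx)
        (fun x hx y hy => by
          have := norm_iteratedFDerivWithin_sub_le_of_holderNorm hFK hx hy
          rwa [Nat.add_sub_cancel] at this) ha) K.coe_nonneg k
    refine ⟨f, hf, fun x hx => (hfe x hx).trans ?_⟩
    have h1 : (K : ℝ) / N ^ (p + 1) ≤ ζ / 2 := by
      have h2 : κ / ζ ≤ (N : ℝ) ^ (p + 1) := by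
        rw [← hYpow]
        exact pow_le_pow_left₀ (by linarith) hYN _
      rw [div_le_iff₀ (by positivity)]
      calc (K : ℝ) ≤ ζ / 2 * (κ / ζ) := by
            rw [hκ]; field_simp; linarith
        _ ≤ _ := mul_le_mul_of_nonneg_left h2 (by positivity)
    have h2 : ((N : ℝ) + 1) ^ d * (d + 1) ^ p * (B * ((d + p) * (1 / 4 ^ k))) ≤ ζ / 2 := by
      have h3 : ((N : ℝ) + 1) ^ d * (d + 1) ^ p * (B * ((d + p) * (1 / 4 ^ k))) =
          ((N : ℝ) + 1) ^ d * ((d + 1) ^ p * (B * (d + p))) / 4 ^ k := by ring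
      rw [h3, div_le_iff₀ (by positivity)]
      calc ((N : ℝ) + 1) ^ d * ((d + 1) ^ p * (B * (d + p)))
          ≤ C₁ * Z * ((d + 1) ^ p * (B * (d + p))) :=
            mul_le_mul_of_nonneg_right hNd (by positivity)
        _ = (C₂ - 1) / 2 * Z := by rw [hC₂]; ring
        _ ≤ C₂ / 2 * Z := mul_le_mul_of_nonneg_right (by linarith) hZ0.le
        _ = ζ / 2 * (C₂ * (Z / ζ)) := by field_simp
        _ ≤ _ := mul_le_mul_of_nonneg_left h4k (by positivity)
    linarith

/-! ### Bump functions around the sample points -/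

/-- The function that is `1` on the cube of radius `r` around `c`, and vanishes outside the cube of
radius `s`. -/
noncomputable def bump (c : Fin d → ℝ) (r s : ℝ) (x : Fin d → ℝ) : ℝ :=
  max (1 - (s - r)⁻¹ * ∑ j, (max (x j - c j - r) 0 + max (c j - x j - r) 0)) 0

lemma bump_nonneg (c : Fin d → ℝ) (r s : ℝ) (x : Fin d → ℝ) : 0 ≤ bump c r s x :=
  le_max_right _ _

lemma bump_eq_one {c : Fin d → ℝ} {r : ℝ} (s : ℝ) {x : Fin d → ℝ} (h : dist x c ≤ r) :
    bump c r s x = 1 := by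
  have h0 : ∑ j, (max (x j - c j - r) 0 + max (c j - x j - r) 0) = 0 := by
    refine Finset.sum_eq_zero fun j _ => ?_
    have h1 := (dist_le_pi_dist x c j).trans h
    rw [Real.dist_eq, abs_le] at h1
    rw [max_eq_right (by linarith), max_eq_right (by linarith), add_zero]
  simp [bump, h0]

lemma bump_eq_zero {c : Fin d → ℝ} {r s : ℝ} (hrs : r < s) (hs : 0 < s) {x : Fin d → ℝ}
    (h : s ≤ dist x c) : bump c r s x = 0 := by
  have h0 : ∃ j, s ≤ dist (x j) (c j) := by
    by_contra! h1
    exact absurd ((dist_pi_lt_iff hs).2 h1) (not_lt.2 h)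
  obtain ⟨j, hj⟩ := h0
  have h1 : s - r ≤ ∑ j, (max (x j - c j - r) 0 + max (c j - x j - r) 0) := by
    refine le_trans ?_ (Finset.single_le_sum
      (f := fun j => max (x j - c j - r) 0 + max (c j - x j - r) 0)
      (fun j _ => add_nonneg (le_max_right _ _) (le_max_right _ _)) (Finset.mem_univ j))
    have h2 := le_max_left (x j - c j - r) 0
    have h3 := le_max_left (c j - x j - r) 0
    have h4 := le_max_right (x j - c j - r) 0
    have h5 := le_max_right (c j - x j - r) 0
    rw [Real.dist_eq] at hj
    rcases abs_cases (x j - c j) with ⟨h6, _⟩ | ⟨h6, _⟩ <;> rw [h6] at hj <;> linarith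
  refine max_eq_right ?_
  have hsr : 0 < s - r := sub_pos.2 hrs
  have h2 : 1 ≤ (s - r)⁻¹ * ∑ j, (max (x j - c j - r) 0 + max (c j - x j - r) 0) := by
    rw [inv_mul_eq_div, le_div_iff₀ hsr, one_mul]
    exact h1
  linarith

/-- A bound for the number of parameters of a network that computes a bump function. -/
def bumpSize (d : ℕ) : ℕ := (2 * d + 1) * (d + 2) + (2 * d + 1) * (2 * d + 2)

/-- Summing the coordinate excesses, rather than taking their maximum, leaves an affine combination
of `2 * d` ReLU units; one further unit makes the outer cut-off. -/
lemma realizes_bump (c : Fin d → ℝ) (r s : ℝ) :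
    Realizes d 1 (2 * d + 1) (bumpSize d) (bump c r s) := by
  classical
  have h := ((HasState.init (d := d) (ι := (Fin d × Bool) ⊕ Unit)
    (Sum.elim (fun p => Pi.single p.1 (if p.2 then 1 else -1)) fun _ _ => 0)
    (Sum.elim (fun p => if p.2 then -c p.1 - r else c p.1 - r) fun _ => 0)).step
    (fun _ => Sum.elim (fun _ => -(s - r)⁻¹) fun _ => 0) fun _ => 1).realizes (Sum.inr ())
  have hc : Fintype.card ((Fin d × Bool) ⊕ Unit) = 2 * d + 1 := by
    simp [Fintype.card_sum, Fintype.card_prod, mul_comm]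
  rw [hc, zero_add, one_mul] at h
  obtain ⟨ι, _, G, h1, h2, h3⟩ := h
  refine ⟨ι, _, G, h1, h2, fun x => ?_⟩
  rw [h3, bump]
  simp only [Fintype.sum_sum_type, Fintype.sum_prod_type, Fintype.sum_bool, Sum.elim_inl,
    Sum.elim_inr, zero_mul, Finset.sum_const_zero, add_zero, Pi.single_apply, ite_mul,
    Finset.sum_ite_eq', Finset.mem_univ, if_true, Bool.false_eq_true, if_false, one_mul, neg_mul]
  rw [sub_eq_add_neg 1, add_comm _ (1 : ℝ), Finset.mul_sum, ← Finset.sum_neg_distrib]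
  congr 2
  refine Finset.sum_congr rfl fun j _ => ?_
  ring_nf

/-- The function `g - 1 / 2`, modified near the points `c i`: upwards for `i ∈ T`, and downwards
for the other `i`. -/
noncomputable def bumped {n : ℕ} (g : (Fin d → ℝ) → ℝ) (c : Fin n → Fin d → ℝ)
    (T : Finset (Fin n)) (r s : ℝ) (x : Fin d → ℝ) : ℝ :=
  g x + (-(1 / 2)) * 1 + 2 * (∑ i ∈ T, bump (c i) r s x) + (-2) * ∑ i ∈ Tᶜ, bump (c i) r s x

/-- The bumps of either sign are summed separately, because a non-negative sum can be carried to the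
depth of `g` by a single unit per layer. The parameter count is thus additive in `n` and `l`,
without a product of the two. -/
lemma realizes_bumped {n l W S : ℕ} {g : (Fin d → ℝ) → ℝ} (hg : Realizes d l W S g) (hl : 1 ≤ l)
    (c : Fin n → Fin d → ℝ) (T : Finset (Fin n)) (r s : ℝ) :
    Realizes d l (W + (l + 1) + 2 * (n * (2 * d + 1) + l))
      (S + (l + (d + 2)) + 2 * (n * bumpSize d + l)) (bumped g c T r s) := by
  have hsum : ∀ T : Finset (Fin n), Realizes d l (n * (2 * d + 1) + l) (n * bumpSize d + l)
      fun x => ∑ i ∈ T, bump (c i) r s x := by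
    intro T
    obtain ⟨k, rfl⟩ := Nat.exists_eq_add_of_le hl
    have h1 := (Realizes.sum T fun i _ => realizes_bump (c i) r s).add_of_nonneg
      (fun x => Finset.sum_nonneg fun i _ => bump_nonneg _ _ _ _) k
    have h2 : T.card ≤ n := by simpa using Finset.card_le_univ T
    refine h1.mono ?_ ?_
    · have := Nat.mul_le_mul_right (2 * d + 1) h2; omega
    · have := Nat.mul_le_mul_right (bumpSize d) h2; omega
  exact (((hg.add ((Realizes.one d l).smul (-(1 / 2)))).add ((hsum T).smul 2)).add
    ((hsum Tᶜ).smul (-2))).mono (by omega) (by omega)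

lemma bumped_of_far {n : ℕ} {g : (Fin d → ℝ) → ℝ} {c : Fin n → Fin d → ℝ}
    {T : Finset (Fin n)} {r s : ℝ} (hrs : r < s) (hs : 0 < s) {x : Fin d → ℝ}
    (h : ∀ i, s ≤ dist x (c i)) : bumped g c T r s x = g x - 1 / 2 := by
  have h0 : ∀ i, bump (c i) r s x = 0 := fun i => bump_eq_zero hrs hs (h i)
  simp only [bumped, h0, Finset.sum_const_zero]
  ring

lemma bumped_of_near {n : ℕ} {g : (Fin d → ℝ) → ℝ} {c : Fin n → Fin d → ℝ}
    {T : Finset (Fin n)} {r s : ℝ} (hrs : r < s) (hs : 0 < s) {x : Fin d → ℝ} (i : Fin n)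
    (hi : dist x (c i) ≤ r) (h : ∀ j, j ≠ i → s ≤ dist x (c j)) :
    bumped g c T r s x = g x - 1 / 2 + if i ∈ T then 2 else -2 := by
  classical
  have h0 : ∀ j, bump (c j) r s x = if j = i then 1 else 0 := by
    intro j
    split_ifs with hj
    · rw [hj]; exact bump_eq_one s hi
    · exact bump_eq_zero hrs hs (h j hj)
  simp only [bumped, h0, Finset.sum_ite_eq', Finset.mem_compl]
  by_cases hT : i ∈ T <;> simp [hT] <;> ring

/-! ### Discretized samples -/

variable {n : ℕ} {X : Set (Fin d → ℝ)}

/-- The sample with the inputs rounded to the grid of mesh `h`. -/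
noncomputable def discretize (h : ℝ) (D : Fin n → X × Label) : Fin n → (Fin d → ℤ) × Prop :=
  fun i => (fun j => ⌊((D i).1 : Fin d → ℝ) j / h⌋, ((D i).2 : ℝ) = 1)

lemma measurable_discretize (h : ℝ) : Measurable (discretize h : (Fin n → X × Label) → _) := by
  refine measurable_pi_lambda _ fun i => Measurable.prodMk ?_ ?_
  · refine measurable_pi_lambda _ fun j => Int.measurable_floor.comp ?_
    have h1 : Measurable fun D : Fin n → X × Label => ((D i).1 : Fin d → ℝ) :=
      measurable_subtype_coe.comp (measurable_fst.comp (measurable_pi_apply i))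
    exact ((measurable_pi_apply j).comp h1).div_const h
  · have h1 : Measurable fun D : Fin n → X × Label => ((D i).2 : ℝ) :=
      measurable_subtype_coe.comp (measurable_snd.comp (measurable_pi_apply i))
    exact measurableSet_setOfPred.1 (h1 (measurableSet_singleton (1 : ℝ)))

/-- The grid point that belongs to a vector of integers. -/
def gridPoint (h : ℝ) (z : Fin d → ℤ) : Fin d → ℝ := fun j => h * z j

lemma dist_gridPoint_le {h : ℝ} (hh : 0 < h) (D : Fin n → X × Label) (i : Fin n) :
    dist ((D i).1 : Fin d → ℝ) (gridPoint h (discretize h D i).1) ≤ h := by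
  refine (dist_pi_le_iff hh.le).2 fun j => ?_
  have h1 := Int.floor_le (((D i).1 : Fin d → ℝ) j / h)
  have h2 := Int.lt_floor_add_one (((D i).1 : Fin d → ℝ) j / h)
  rw [le_div_iff₀ hh] at h1
  rw [div_lt_iff₀ hh] at h2
  simp only [gridPoint, discretize]
  rw [Real.dist_eq, abs_le]
  constructor <;> nlinarith

/-- The separation distance is half the minimal distance, and `δ` is less than a third of it; hence
the factor `6`. -/
lemma lt_dist_of_mem_admissible {δ : ℝ} {D : Fin n → X × Label} (hD : D ∈ admissible X n δ)
    {i j : Fin n} (hij : i ≠ j) : 6 * δ < dist ((D i).1 : Fin d → ℝ) (D j).1 := by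
  have h1 : ENNReal.ofReal δ < edist (D i).1 (D j).1 / 2 / 3 := by
    refine lt_of_lt_of_le hD ?_
    refine ENNReal.div_le_div_right (ENNReal.div_le_div_right ?_ _) _
    exact iInf_le_of_le i (iInf_le_of_le j (iInf_le_of_le hij le_rfl))
  have h2 : edist (D i).1 (D j).1 / 2 / 3 = ENNReal.ofReal (dist (D i).1 (D j).1 / 2 / 3) := by
    rw [edist_dist, ENNReal.ofReal_div_of_pos (by norm_num), ENNReal.ofReal_div_of_pos (by norm_num)]
    norm_num
  rw [h2] at h1
  have h3 := (ENNReal.ofReal_lt_ofReal_iff'.1 h1).1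
  rw [Subtype.dist_eq] at h3
  linarith

/-- There are only boundedly many `6 δ`-separated points in the cube. -/
lemma card_le_of_admissible {δ : ℝ} (hδ : 0 < δ) (hX : X ⊆ cube d) {D : Fin n → X × Label}
    (hD : D ∈ admissible X n δ) : n ≤ (⌊1 / (6 * δ)⌋₊ + 1) ^ d := by
  have h6 : 0 < 6 * δ := by linarith
  -- Each input is sent to its half-open grid cell of side `6 * δ`; two inputs in one cell would be
  -- too close.
  let e : Fin n → Fin d → Fin (⌊1 / (6 * δ)⌋₊ + 1) := fun i j =>
    ⟨⌊((D i).1 : Fin d → ℝ) j / (6 * δ)⌋₊, Nat.lt_succ_of_le (Nat.floor_le_floor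
      (div_le_div_of_nonneg_right ((hX (D i).1.2).2 j) h6.le))⟩
  have he : Function.Injective e := by
    intro i i' hii
    by_contra hne
    refine absurd (lt_dist_of_mem_admissible hD hne) (not_lt.2 (le_of_lt ?_))
    refine (dist_pi_lt_iff h6).2 fun j => ?_
    have h1 : ⌊((D i).1 : Fin d → ℝ) j / (6 * δ)⌋₊ = ⌊((D i').1 : Fin d → ℝ) j / (6 * δ)⌋₊ :=
      congrArg Fin.val (congrFun hii j)
    have p1 : 0 ≤ ((D i).1 : Fin d → ℝ) j / (6 * δ) := div_nonneg ((hX (D i).1.2).1 j) h6.le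
    have p2 : 0 ≤ ((D i').1 : Fin d → ℝ) j / (6 * δ) := div_nonneg ((hX (D i').1.2).1 j) h6.le
    have a1 := Nat.floor_le p1
    have a2 := Nat.floor_le p2
    have b1 := Nat.lt_floor_add_one (((D i).1 : Fin d → ℝ) j / (6 * δ))
    have b2 := Nat.lt_floor_add_one (((D i').1 : Fin d → ℝ) j / (6 * δ))
    rw [h1] at a1 b1
    rw [le_div_iff₀ h6] at a1 a2
    rw [div_lt_iff₀ h6] at b1 b2
    rw [Real.dist_eq, abs_lt]
    constructor <;> linarith
  simpa using Fintype.card_le_of_injective e he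

/-! ### Population risks -/

/-- Test the norm inequality on the indicator function. Null sets are treated apart, since the
passage to the infimum divides by `ν s`. -/
lemma measure_le_idNorm_mul {Ω : Type*} [MeasurableSpace Ω] {ν μ : Measure Ω}
    (h : idNorm ν μ < ∞) {s : Set Ω} (hs : MeasurableSet s) (hν : ν s ≠ ∞) :
    μ s ≤ idNorm ν μ * ν s := by
  have key : ∀ c ∈ {c | ∀ f : Ω → ℝ, Measurable f → Integrable f ν →
      eLpNorm f 1 μ ≤ c * eLpNorm f 1 ν}, μ s ≤ c * ν s := by
    intro c hc
    have := hc (s.indicator fun _ => 1) (measurable_const.indicator hs)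
      ((integrable_indicator_iff hs).2 (integrableOn_const hν))
    rw [eLpNorm_indicator_const hs one_ne_zero ENNReal.one_ne_top,
      eLpNorm_indicator_const hs one_ne_zero ENNReal.one_ne_top] at this
    simpa using this
  rcases eq_or_ne (ν s) 0 with h0 | h0
  · obtain ⟨c, hc, -⟩ := sInf_lt_iff.1 h
    have := key c hc
    rw [h0, mul_zero] at this ⊢
    exact this
  · rw [← ENNReal.div_le_iff h0 hν]
    exact le_sInf fun c hc => (ENNReal.div_le_iff h0 hν).2 (key c hc)

lemma fst_real_closedBall_le (hX : MeasurableSet X) {ρ : Measure (X × Label)}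
    (hJ : normJ ρ < ∞) (x : X) {r : ℝ} (hr : 0 ≤ r) :
    ρ.fst (Metric.closedBall x r) ≤ normJ ρ * ENNReal.ofReal ((2 * r) ^ d) := by
  have h1 : Measure.comap (Subtype.val : X → Fin d → ℝ) volume (Metric.closedBall x r) ≤
      ENNReal.ofReal ((2 * r) ^ d) := by
    rw [(MeasurableEmbedding.subtype_coe hX).comap_apply]
    refine (measure_mono (t := Metric.closedBall (x : Fin d → ℝ) r) ?_).trans (le_of_eq ?_)
    · rintro _ ⟨y, hy, rfl⟩
      exact hy
    · rw [Real.volume_pi_closedBall _ hr, Fintype.card_fin]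
  refine (measure_le_idNorm_mul hJ Metric.isClosed_closedBall.measurableSet
    (h1.trans_lt ENNReal.ofReal_lt_top).ne).trans ?_
  gcongr
  rfl

lemma real_fst_preimage_iUnion_closedBall_le (hX : MeasurableSet X) {ρ : Measure (X × Label)}
    (hJ : normJ ρ < ∞) {n : ℕ} (x : Fin n → X) {r : ℝ} (hr : 0 ≤ r) :
    ρ.real (Prod.fst ⁻¹' ⋃ i, Metric.closedBall (x i) r) ≤
      (normJ ρ).toReal * (2 * r) ^ d * n := by
  have h1 : ρ (Prod.fst ⁻¹' ⋃ i, Metric.closedBall (x i) r) ≤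
      n * (normJ ρ * ENNReal.ofReal ((2 * r) ^ d)) := by
    rw [← Measure.fst_apply (MeasurableSet.iUnion fun i =>
      Metric.isClosed_closedBall.measurableSet)]
    refine (measure_iUnion_le _).trans ?_
    rw [tsum_fintype]
    refine (Finset.sum_le_sum fun i _ => fst_real_closedBall_le hX hJ (x i) hr).trans ?_
    simp
  rw [measureReal_def]
  refine (ENNReal.toReal_mono ?_ h1).trans (le_of_eq ?_)
  · exact ENNReal.mul_ne_top (by simp) (ENNReal.mul_ne_top hJ.ne ENNReal.ofReal_ne_top)
  · rw [ENNReal.toReal_mul, ENNReal.toReal_mul, ENNReal.toReal_ofReal (by positivity),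
      ENNReal.toReal_natCast]
    ring

lemma label_eq (y : Label) : (y : ℝ) = 1 ∨ (y : ℝ) = -1 := by
  rcases y.2 with h | h
  · exact Or.inr h
  · exact Or.inl h

lemma bayes_eq (κ : Kernel X Label) (x : X) : bayes κ x = 1 ∨ bayes κ x = -1 := by
  unfold bayes
  split_ifs <;> simp

lemma measurableSet_label (a : ℝ) : MeasurableSet {y : Label | (y : ℝ) = a} :=
  measurable_subtype_coe (measurableSet_singleton a)

lemma measurable_bayes (κ : Kernel X Label) [IsMarkovKernel κ] : Measurable (bayes κ) := by
  refine Measurable.ite (measurableSet_le ?_ ?_) measurable_const measurable_const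
  · exact (κ.measurable_coe (measurableSet_label (-1))).ennreal_toReal
  · exact (κ.measurable_coe (measurableSet_label 1)).ennreal_toReal

lemma eta_add (κ : Kernel X Label) [IsMarkovKernel κ] (x : X) :
    eta κ x + (κ x).real {y | (y : ℝ) = -1} = 1 := by
  rw [eta, ← measureReal_union ?_ (measurableSet_label (-1))]
  · refine Eq.trans ?_ (probReal_univ (μ := κ x))
    congr 1
    exact Set.eq_univ_of_forall label_eq
  · rw [Set.disjoint_left]
    intro y hy hy'
    simp only [Set.mem_ofPred_eq] at hy hy'
    linarith

lemma bayes_eq_ite (κ : Kernel X Label) [IsMarkovKernel κ] (x : X) :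
    bayes κ x = if 1 / 2 ≤ eta κ x then 1 else -1 := by
  have h := eta_add κ x
  unfold bayes
  refine if_congr ?_ rfl rfl
  change _ ≤ eta κ x ↔ _
  constructor <;> intro <;> linarith

/-- After disintegration the Bayes rule minimizes the conditional error at every `x`: it errs on the
less likely label. -/
lemma misclass_bayes_le {ρ : Measure (X × Label)} [IsProbabilityMeasure ρ]
    {κ : Kernel X Label} [IsMarkovKernel κ] [ρ.IsCondKernel κ] {g : X → ℝ} (hg : Measurable g)
    (hg1 : ∀ x, g x = 1 ∨ g x = -1) : misclass ρ (bayes κ) ≤ misclass ρ g := by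
  have hm : ∀ g : X → ℝ, Measurable g →
      MeasurableSet {z : X × Label | (z.2 : ℝ) * g z.1 = -1} := fun g hg =>
    ((measurable_subtype_coe.comp measurable_snd).mul (hg.comp measurable_fst))
      (measurableSet_singleton (-1))
  have hρ : ∀ g : X → ℝ, Measurable g → ρ {z : X × Label | (z.2 : ℝ) * g z.1 = -1} =
      ∫⁻ x, κ x {y | (y : ℝ) * g x = -1} ∂ρ.fst := by
    intro g hg
    conv_lhs => rw [← ρ.disintegrate κ]
    rw [Measure.compProd_apply (hm g hg)]
    rfl
  refine ENNReal.toReal_mono (measure_ne_top _ _) ?_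
  rw [hρ _ (measurable_bayes κ), hρ g hg]
  refine lintegral_mono fun x => ?_
  have e1 : {y : Label | (y : ℝ) * 1 = -1} = {y : Label | (y : ℝ) = -1} := by simp
  have e2 : {y : Label | (y : ℝ) * -1 = -1} = {y : Label | (y : ℝ) = 1} := by simp
  by_cases h : (κ x).real {y | (y : ℝ) = -1} ≤ (κ x).real {y | (y : ℝ) = 1}
  · have hb : bayes κ x = 1 := if_pos h
    rcases hg1 x with h1 | h1
    · simp only [hb, h1, le_refl]
    · simp only [hb, h1, e1, e2]
      exact (ENNReal.toReal_le_toReal (measure_ne_top _ _) (measure_ne_top _ _)).1 h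
  · have hb : bayes κ x = -1 := if_neg h
    rcases hg1 x with h1 | h1
    · simp only [hb, h1, e1, e2]
      exact (ENNReal.toReal_le_toReal (measure_ne_top _ _) (measure_ne_top _ _)).1 (le_of_not_ge h)
    · simp only [hb, h1, le_refl]

lemma misclass_bayes_le_bestAdvMisclass {ρ : Measure (X × Label)} [IsProbabilityMeasure ρ]
    (κ : Kernel X Label) [IsMarkovKernel κ] [ρ.IsCondKernel κ] {δ : ℝ} (hδ : 0 ≤ δ) :
    misclass ρ (bayes κ) ≤ bestAdvMisclass ρ δ := by
  have : Nonempty {g : X → ℝ // Measurable g ∧ ∀ x, g x = 1 ∨ g x = -1} :=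
    ⟨⟨bayes κ, measurable_bayes κ, bayes_eq κ⟩⟩
  refine le_ciInf fun g => (misclass_bayes_le g.2.1 g.2.2).trans ?_
  exact measureReal_mono fun z hz => ⟨z.1, Metric.mem_closedBall_self hδ, hz⟩

/-- A classifier that agrees with the Bayes rule outside some balls is misclassified with little
additional probability. -/
lemma misclass_sub_le (hX : MeasurableSet X) {ρ : Measure (X × Label)} [IsProbabilityMeasure ρ]
    {κ : Kernel X Label} (hJ : normJ ρ < ∞) {n : ℕ} (x : Fin n → X) {r : ℝ} (hr : 0 ≤ r)
    {g : X → ℝ} (hg : ∀ z, (∀ i, r < dist z (x i)) → g z = bayes κ z) :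
    misclass ρ g - misclass ρ (bayes κ) ≤ (normJ ρ).toReal * (2 * r) ^ d * n := by
  rw [sub_le_iff_le_add']
  refine le_trans ?_ (add_le_add_right (real_fst_preimage_iUnion_closedBall_le hX hJ x hr) _)
  refine le_trans (measureReal_mono ?_) (measureReal_union_le _ _)
  intro z hz
  by_cases h : ∃ i, dist z.1 (x i) ≤ r
  · exact Or.inr (Set.mem_iUnion.2 h)
  · push Not at h
    refine Or.inl ?_
    change (z.2 : ℝ) * g z.1 = -1 at hz
    rw [hg z.1 h] at hz
    exact hz

lemma bayes_eq_of_dist_le {κ : Kernel X Label} {δ : ℝ} (hδ : 0 < δ) (hκ : Separated κ δ)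
    {x x' : X} (h : dist x x' ≤ δ) : bayes κ x = bayes κ x' := by
  rcases bayes_eq κ x with h1 | h1 <;> rcases bayes_eq κ x' with h2 | h2
  · rw [h1, h2]
  · have := hκ x x' h1 h2; linarith
  · have := hκ x' x h2 h1; rw [dist_comm] at this; linarith
  · rw [h1, h2]

/-- Away from the balls of radius `r + δ`, an adversarial point `x'` is still outside the balls of
radius `r`, so `g x'` is the Bayes label of `x'`, which by separation is that of the attacked point.
An adversarial error there is an ordinary error of the Bayes rule. -/
lemma advMisclass_sub_le (hX : MeasurableSet X) {ρ : Measure (X × Label)}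
    [IsProbabilityMeasure ρ] {κ : Kernel X Label} [IsMarkovKernel κ] [ρ.IsCondKernel κ]
    (hJ : normJ ρ < ∞) {δ : ℝ} (hδ : 0 < δ) (hκ : Separated κ δ) {n : ℕ} (x : Fin n → X)
    {r : ℝ} (hr : 0 ≤ r) {g : X → ℝ} (hg : ∀ z, (∀ i, r < dist z (x i)) → g z = bayes κ z) :
    advMisclass ρ δ g - bestAdvMisclass ρ δ ≤ (normJ ρ).toReal * (2 * (r + δ)) ^ d * n := by
  rw [sub_le_iff_le_add']
  refine le_trans ?_ (add_le_add (misclass_bayes_le_bestAdvMisclass κ hδ.le)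
    (real_fst_preimage_iUnion_closedBall_le hX hJ x (add_nonneg hr hδ.le)))
  refine le_trans (measureReal_mono ?_) (measureReal_union_le _ _)
  rintro z ⟨x', hx', hz⟩
  by_cases h : ∃ i, dist z.1 (x i) ≤ r + δ
  · exact Or.inr (Set.mem_iUnion.2 h)
  · push Not at h
    refine Or.inl ?_
    rw [hg x' fun i => ?_, bayes_eq_of_dist_le hδ hκ hx'] at hz
    · exact hz
    · have h1 := h i
      have h2 := dist_triangle z.1 x' (x i)
      have h3 : dist x' z.1 ≤ δ := hx'
      rw [dist_comm] at h3
      linarith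

lemma sgn_eq_bayes {κ : Kernel X Label} [IsMarkovKernel κ] {ζ : ℝ} {x : X}
    (hη : ζ < |eta κ x - 1 / 2|) {t : ℝ} (ht : |eta κ x - t| ≤ ζ) :
    sgn (t - 1 / 2) = bayes κ x := by
  rw [bayes_eq_ite, sgn]
  rw [abs_le] at ht
  refine if_congr ?_ rfl rfl
  rcases lt_abs.1 hη with h | h
  · constructor <;> intro <;> linarith
  · constructor <;> intro <;> linarith

/-! ### Empirical adversarial risk -/

lemma empAdvRisk_nonneg {n : ℕ} (D : Fin n → X × Label) (δ : ℝ) (f : X → ℝ) :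
    0 ≤ empAdvRisk D δ f :=
  mul_nonneg (by positivity) (Finset.sum_nonneg fun _ _ => Real.iSup_nonneg fun _ =>
    le_max_right _ _)

lemma mem_globalMinima {n : ℕ} {D : Fin n → X × Label} {δ : ℝ} {w : ℕ → ℕ} {L : ℕ} {f : X → ℝ}
    (hf : f ∈ hypothesisSpace X w L)
    (h : ∀ i, ∀ x' : X, dist x' (D i).1 ≤ δ → 1 ≤ ((D i).2 : ℝ) * f x') :
    f ∈ globalMinima D δ w L := by
  refine ⟨hf, fun g _ => ?_⟩
  have h0 : empAdvRisk D δ f = 0 := by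
    unfold empAdvRisk
    refine mul_eq_zero_of_right _ (Finset.sum_eq_zero fun i _ => ?_)
    have h1 : ∀ x' : Metric.closedBall (D i).1 δ, hinge (((D i).2 : ℝ) * f x') = 0 := fun x' =>
      max_eq_right (by linarith [h i x' x'.2])
    simp only [h1]
    exact Real.iSup_const_zero
  change empAdvRisk D δ f ≤ empAdvRisk D δ g
  rw [h0]
  exact empAdvRisk_nonneg D δ g

/-! ### Robust interpolation and the learning rules. -/

/-- The network function that a sample determines: an approximation `g` of `η`, shifted by `1 / 2`
and corrected by bumps around the sample points, which are rounded to the grid of mesh `h`. -/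
noncomputable def trained {n : ℕ} (g : (Fin d → ℝ) → ℝ) (δ h : ℝ)
    (z : Fin n → (Fin d → ℤ) × Prop) : (Fin d → ℝ) → ℝ :=
  open Classical in
  bumped g (fun i => gridPoint h (z i).1) (Finset.univ.filter fun i => (z i).2) (δ + h)
    (δ + 3 * h)

/-- Bumps vanish from distance `δ + 3 * h` to their rounded centre on, and rounding moves the centre
by at most `h`. -/
lemma trained_of_far {n : ℕ} {g : (Fin d → ℝ) → ℝ} {δ h : ℝ} (hδ : 0 < δ) (hh : 0 < h)
    (D : Fin n → X × Label) {x : X} (hx : ∀ i, δ + 4 * h < dist x (D i).1) :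
    trained g δ h (discretize h D) x = g x - 1 / 2 := by
  refine bumped_of_far (by linarith) (by linarith) fun i => ?_
  have h1 := dist_gridPoint_le hh D i
  have h3 := hx i
  rw [Subtype.dist_eq] at h3
  have h4 := dist_triangle (x : Fin d → ℝ) (gridPoint h (discretize h D i).1) (D i).1
  rw [dist_comm (gridPoint h (discretize h D i).1)] at h4
  linarith

/-- The plateau of radius `δ + h` around the rounded input covers the `δ`-ball around the true one.
Every other rounded input is at distance at least `6 * δ - δ - h`, beyond the support radius `δ + 3
* h`. -/
lemma trained_of_near {n : ℕ} {g : (Fin d → ℝ) → ℝ} {δ h : ℝ} (hh : 0 < h)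
    (hhδ : 4 * h ≤ δ) {D : Fin n → X × Label} (hD : D ∈ admissible X n δ) {x : X} (i : Fin n)
    (hi : dist x (D i).1 ≤ δ) :
    trained g δ h (discretize h D) x = g x - 1 / 2 + 2 * ((D i).2 : ℝ) := by
  classical
  rw [Subtype.dist_eq] at hi
  rw [trained, bumped_of_near (by linarith) (by linarith) i ?_ fun j hj => ?_]
  · congr 1
    rcases label_eq (D i).2 with h1 | h1
    · have h2 : (discretize h D i).2 := h1
      rw [if_pos (by simp [h2]), h1, mul_one]
    · have h2 : ¬ (discretize h D i).2 := fun h2 => by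
        have h3 : ((D i).2 : ℝ) = 1 := h2
        linarith
      rw [if_neg (by simp [h2]), h1]
      norm_num
  · have h1 := dist_gridPoint_le hh D i
    have h2 := dist_triangle (x : Fin d → ℝ) (D i).1 (gridPoint h (discretize h D i).1)
    linarith
  · have h1 := dist_gridPoint_le hh D j
    have h2 := dist_triangle (x : Fin d → ℝ) (gridPoint h (discretize h D j).1) (D j).1
    rw [dist_comm (gridPoint h (discretize h D j).1)] at h2
    have h3 := lt_dist_of_mem_admissible hD hj
    have h4 := dist_triangle_left ((D j).1 : Fin d → ℝ) (D i).1 x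
    linarith

lemma sgn_mul {c : ℝ} (hc : 0 < c) (t : ℝ) : sgn (c * t) = sgn t := by
  simp only [sgn, mul_nonneg_iff_of_pos_left hc]

lemma misclass_mem (ρ : Measure (X × Label)) [IsProbabilityMeasure ρ] (g : X → ℝ) :
    0 ≤ misclass ρ g ∧ misclass ρ g ≤ 1 :=
  ⟨measureReal_nonneg, measureReal_le_one⟩

lemma advMisclass_mem (ρ : Measure (X × Label)) [IsProbabilityMeasure ρ] (δ : ℝ) (g : X → ℝ) :
    0 ≤ advMisclass ρ δ g ∧ advMisclass ρ δ g ≤ 1 :=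
  ⟨measureReal_nonneg, measureReal_le_one⟩

/-- A bounded function of the sample that depends only on the discretized sample is integrable, and
its conditional mean satisfies every non-negative pointwise upper bound. -/
lemma integrable_comp_discretize {n : ℕ} {P : Measure (Fin n → X × Label)}
    [IsProbabilityMeasure P] (s : Set (Fin n → X × Label)) (h : ℝ)
    (Φ : (Fin n → (Fin d → ℤ) × Prop) → ℝ) {c b : ℝ} (hc : ∀ z, |Φ z - c| ≤ 1 + |c|)
    (hb0 : 0 ≤ b) (hb : ∀ D : Fin n → X × Label, Φ (discretize h D) - c ≤ b) :
    Integrable (fun D => Φ (discretize h D) - c) (cond P s) ∧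
      ∫ D, (Φ (discretize h D) - c) ∂(cond P s) ≤ b := by
  -- Rounded samples form a countable space, on which every function is measurable, so `Φ` may come
  -- from arbitrary choices.
  have hm : Measurable fun D : Fin n → X × Label => Φ (discretize h D) - c :=
    ((measurable_of_countable Φ).comp (measurable_discretize h)).sub_const c
  have hi : Integrable (fun D => Φ (discretize h D) - c) (cond P s) :=
    Integrable.of_bound hm.aestronglyMeasurable (1 + |c|) (Filter.Eventually.of_forall fun D =>
      hc (discretize h D))
  refine ⟨hi, ?_⟩
  rcases eq_or_ne (P s) 0 with h0 | h0
  · rw [cond_eq_zero_of_meas_eq_zero h0, integral_zero_measure]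
    exact hb0
  · have := cond_isProbabilityMeasure h0
    calc _ ≤ ∫ _, b ∂(cond P s) := integral_mono hi (integrable_const b) hb
      _ = b := by simp

/-- The learning rules of the theorem, for networks that are large enough. -/
lemma exists_learning_rules (hX : MeasurableSet X) {ρ : Measure (X × Label)}
    [IsProbabilityMeasure ρ] {κ : Kernel X Label} [IsMarkovKernel κ] [ρ.IsCondKernel κ]
    (hJ : normJ ρ < ∞) {δ : ℝ} (hδ : 0 < δ) (hκ : Separated κ δ) {ζ : ℝ}
    (hη : ∀ x : X, ζ < |eta κ x - 1 / 2|) {n : ℕ} (hn : 1 ≤ n) {C₀ : ℝ} (hC₀ : 0 < C₀)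
    (hC₀' : C₀ ≤ 1) {l W S : ℕ} {g : (Fin d → ℝ) → ℝ}
    (hreal : ∀ z : Fin n → (Fin d → ℤ) × Prop, Realizes d l W S (trained g δ (C₀ * δ / 4) z))
    (hg : ∀ x : X, |eta κ x - g x| ≤ ζ) :
    ∃ N : ℕ → (Fin n → X × Label) → Net d (fun _ => W) (l + 1),
      (∀ D ∈ admissible X n δ,
        (Function.Injective fun j => (N j D).toFun X) ∧
        ∀ j,
          (N j D).toFun X ∈ globalMinima D δ (fun _ => W) (l + 1) ∧
          (N j D).numNonzero ≤ S ∧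
          misclass ρ (fun x => sgn ((N j D).toFun X x)) - misclass ρ (bayes κ)
            ≤ 2 * (normJ ρ).toReal * ((2 + 2 * C₀) * δ) ^ d * n ∧
          advMisclass ρ δ (fun x => sgn ((N j D).toFun X x)) - bestAdvMisclass ρ δ
            ≤ 3 * (normJ ρ).toReal * ((4 + 2 * C₀) * δ) ^ d * n) ∧
      ∀ j,
        Integrable
          (fun D => misclass ρ (fun x => sgn ((N j D).toFun X x)) - misclass ρ (bayes κ))
          (cond (Measure.pi fun _ : Fin n => ρ) (admissible X n δ)) ∧
        (∫ D, (misclass ρ (fun x => sgn ((N j D).toFun X x)) - misclass ρ (bayes κ))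
            ∂(cond (Measure.pi fun _ : Fin n => ρ) (admissible X n δ)))
          ≤ 2 * (normJ ρ).toReal * ((2 + 2 * C₀) * δ) ^ d * n ∧
        Integrable
          (fun D => advMisclass ρ δ (fun x => sgn ((N j D).toFun X x)) - bestAdvMisclass ρ δ)
          (cond (Measure.pi fun _ : Fin n => ρ) (admissible X n δ)) ∧
        (∫ D, (advMisclass ρ δ (fun x => sgn ((N j D).toFun X x)) - bestAdvMisclass ρ δ)
            ∂(cond (Measure.pi fun _ : Fin n => ρ) (admissible X n δ)))
          ≤ 3 * (normJ ρ).toReal * ((4 + 2 * C₀) * δ) ^ d * n := by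
  -- With this mesh the modified region has radius `δ + 4 * h = (1 + C₀) * δ`.
  set h := C₀ * δ / 4 with hh
  have hh0 : 0 < h := by positivity
  have h4h : 4 * h = C₀ * δ := by rw [hh]; ring
  have h4δ : 4 * h ≤ δ := by rw [h4h]; nlinarith
  -- The factor `j + 1 ≥ 1` changes the function, but neither its signs nor a margin of at least
  -- `1`.
  choose M hM1 hM2 using fun (j : ℕ) z => ((hreal z).smul ((j : ℝ) + 1)).exists_net
  have hev : ∀ j z (x : X), (M j z).toFun X x = ((j : ℝ) + 1) * trained g δ h z x :=
    fun j z x => hM2 j z x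
  have hfar : ∀ j (D : Fin n → X × Label) (x : X), (∀ i, δ + 4 * h < dist x (D i).1) →
      sgn ((M j (discretize h D)).toFun X x) = bayes κ x := by
    intro j D x hx
    rw [hev, sgn_mul (by positivity), trained_of_far hδ hh0 D hx]
    exact sgn_eq_bayes (hη x) (hg x)
  have hJ0 : 0 ≤ (normJ ρ).toReal := ENNReal.toReal_nonneg
  have hmis : ∀ j (D : Fin n → X × Label),
      misclass ρ (fun x => sgn ((M j (discretize h D)).toFun X x)) - misclass ρ (bayes κ)
        ≤ 2 * (normJ ρ).toReal * ((2 + 2 * C₀) * δ) ^ d * n := by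
    intro j D
    refine (misclass_sub_le hX hJ (fun i => (D i).1) (by positivity) (hfar j D)).trans ?_
    rw [show 2 * (δ + 4 * h) = (2 + 2 * C₀) * δ by rw [h4h]; ring]
    have : 0 ≤ (normJ ρ).toReal * ((2 + 2 * C₀) * δ) ^ d * n := by positivity
    linarith
  have hadv : ∀ j (D : Fin n → X × Label),
      advMisclass ρ δ (fun x => sgn ((M j (discretize h D)).toFun X x)) - bestAdvMisclass ρ δ
        ≤ 3 * (normJ ρ).toReal * ((4 + 2 * C₀) * δ) ^ d * n := by
    intro j D
    refine (advMisclass_sub_le hX hJ hδ hκ (fun i => (D i).1) (by positivity)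
      (hfar j D)).trans ?_
    rw [show 2 * (δ + 4 * h + δ) = (4 + 2 * C₀) * δ by rw [h4h]; ring]
    have : 0 ≤ (normJ ρ).toReal * ((4 + 2 * C₀) * δ) ^ d * n := by positivity
    linarith
  have hη01 : ∀ x : X, 0 ≤ eta κ x ∧ eta κ x ≤ 1 := fun x =>
    ⟨measureReal_nonneg, measureReal_le_one⟩
  have hmargin : ∀ D ∈ admissible X n δ, ∀ i, ∀ x : X, dist x (D i).1 ≤ δ →
      1 ≤ ((D i).2 : ℝ) * trained g δ h (discretize h D) x := by
    intro D hD i x hx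
    rw [trained_of_near hh0 h4δ hD i hx]
    have h1 := hη x
    have h2 := hg x
    obtain ⟨h3, h4⟩ := hη01 x
    rw [abs_le] at h2
    -- `ζ` is below `|η - 1/2| ≤ 1/2`, so `g - 1/2` is at most `1` in size and the bump of height
    -- `2` leaves a margin of at least `1`.
    have h5 : |g x - 1 / 2| ≤ 1 := by
      rw [abs_le]
      rcases lt_abs.1 h1 with h6 | h6 <;> constructor <;> linarith
    rw [abs_le] at h5
    rcases label_eq (D i).2 with hy | hy <;> rw [hy] <;> linarith
  refine ⟨fun j D => M j (discretize h D), fun D hD => ⟨fun j j' hjj => ?_, fun j =>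
    ⟨?_, hM1 j _, hmis j D, hadv j D⟩⟩, fun j => ?_⟩
  -- By the margin, the unscaled function does not vanish at a sample input, so equal multiples have
  -- equal factors.
  · let i₀ : Fin n := ⟨0, hn⟩
    have h1 := congrFun hjj (D i₀).1
    simp only [hev] at h1
    have h2 := hmargin D hD i₀ (D i₀).1 (by simpa using hδ.le)
    have h3 : trained g δ h (discretize h D) (D i₀).1 ≠ 0 := by
      intro h4
      rw [h4, mul_zero] at h2
      linarith
    have h4 := mul_right_cancel₀ h3 h1
    exact_mod_cast add_right_cancel h4
  · refine mem_globalMinima ⟨_, rfl⟩ fun i x hx => ?_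
    rw [hev]
    have h1 := hmargin D hD i x hx
    have h2 : (0 : ℝ) ≤ j := j.cast_nonneg
    rw [mul_left_comm]
    nlinarith
  · have h1 := integrable_comp_discretize (P := Measure.pi fun _ : Fin n => ρ)
      (admissible X n δ) h (fun z => misclass ρ fun x => sgn ((M j z).toFun X x))
      (c := misclass ρ (bayes κ)) (b := 2 * (normJ ρ).toReal * ((2 + 2 * C₀) * δ) ^ d * n)
      (fun z => (abs_sub _ _).trans (add_le_add (by
        rw [abs_of_nonneg (misclass_mem ρ _).1]; exact (misclass_mem ρ _).2) le_rfl))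
      (by positivity) (hmis j)
    have h2 := integrable_comp_discretize (P := Measure.pi fun _ : Fin n => ρ)
      (admissible X n δ) h (fun z => advMisclass ρ δ fun x => sgn ((M j z).toFun X x))
      (c := bestAdvMisclass ρ δ) (b := 3 * (normJ ρ).toReal * ((4 + 2 * C₀) * δ) ^ d * n)
      (fun z => (abs_sub _ _).trans (add_le_add (by
        rw [abs_of_nonneg (advMisclass_mem ρ δ _).1]; exact (advMisclass_mem ρ δ _).2) le_rfl))
      (by positivity) (hadv j)
    exact ⟨h1.1, h1.2, h2.1, h2.2⟩

end AdvTraining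

/-! ### The main theorem. -/

open AdvTraining in
theorem theorem1 (d α : ℕ) (hd : 1 ≤ d) (hα : 1 ≤ α) (K : ℝ≥0) :
    ∃ C : ℝ, 0 < C ∧ ∀ δ : ℝ, 0 < δ → ∃ Cδ : ℝ, 0 < Cδ ∧
      ∀ (X : Set (Fin d → ℝ)), MeasurableSet X → X ⊆ cube d →
      ∀ (ρ : Measure (X × Label)) [IsProbabilityMeasure ρ]
        (κ : Kernel X Label) [IsMarkovKernel κ] [ρ.IsCondKernel κ],
      normJ ρ < ∞ → normJbar ρ < ∞ →
      Separated κ δ →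
      HolderBall α K (eta κ) →
      ∀ ζ : ℝ, 0 < ζ → (∀ x : X, ζ < |eta κ x - 1 / 2|) →
      ∀ n : ℕ, 1 ≤ n →
      ∀ C₀ : ℝ, 0 < C₀ → C₀ ≤ 1 →
      ∃ (L : ℕ) (w : ℕ → ℕ),
        1 ≤ L ∧ (L : ℝ) ≤ C * Real.log (1 / ζ) ∧
        (∀ ℓ < L, (w ℓ : ℝ) ≤ C * (ζ ^ (-((d : ℝ) / α)) * Real.log (1 / ζ) + n)) ∧
        (∀ ℓ < L, 1 ≤ ℓ → (w ℓ : ℝ) ≤ Cδ * (ζ ^ (-((d : ℝ) / α)) * Real.log (1 / ζ))) ∧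
        ∃ N : ℕ → (Fin n → X × Label) → Net d w L,
          (∀ D ∈ admissible X n δ,
            (Function.Injective fun j => (N j D).toFun X) ∧
            ∀ j,
              (N j D).toFun X ∈ globalMinima D δ w L ∧
              ((N j D).numNonzero : ℝ)
                ≤ C * (ζ ^ (-((d : ℝ) / α)) * Real.log (1 / ζ) + n) ∧
              misclass ρ (fun x => sgn ((N j D).toFun X x)) - misclass ρ (bayes κ)
                ≤ 2 * (normJ ρ).toReal
                  * ((2 + 2 * C₀) * δ) ^ d * n ∧
              advMisclass ρ δ (fun x => sgn ((N j D).toFun X x)) - bestAdvMisclass ρ δ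
                ≤ 3 * (normJ ρ).toReal
                  * ((4 + 2 * C₀) * δ) ^ d * n) ∧
          ∀ j,
            Integrable
              (fun D => misclass ρ (fun x => sgn ((N j D).toFun X x)) - misclass ρ (bayes κ))
              (cond (Measure.pi fun _ : Fin n => ρ) (admissible X n δ)) ∧
            (∫ D, (misclass ρ (fun x => sgn ((N j D).toFun X x)) - misclass ρ (bayes κ))
                ∂(cond (Measure.pi fun _ : Fin n => ρ) (admissible X n δ)))
              ≤ 2 * (normJ ρ).toReal
                * ((2 + 2 * C₀) * δ) ^ d * n ∧
            Integrable
              (fun D => advMisclass ρ δ (fun x => sgn ((N j D).toFun X x))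
                - bestAdvMisclass ρ δ)
              (cond (Measure.pi fun _ : Fin n => ρ) (admissible X n δ)) ∧
            (∫ D, (advMisclass ρ δ (fun x => sgn ((N j D).toFun X x))
                - bestAdvMisclass ρ δ)
                ∂(cond (Measure.pi fun _ : Fin n => ρ) (admissible X n δ)))
              ≤ 3 * (normJ ρ).toReal
                * ((4 + 2 * C₀) * δ) ^ d * n := by
  obtain ⟨C, hC, happrox⟩ := exists_realizes_holder d α hα K
  set C' : ℝ := 4 * C + 2 * (d + 2) + 2 * (2 * d + 1) + 2 * bumpSize d + 4 with hC'
  have hC'0 : 0 < C' := by positivity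
  refine ⟨C', hC'0, fun δ hδ => ?_⟩
  -- The packing bound for `n`, through which `C_δ` depends on `δ`.
  set m : ℕ := (⌊1 / (6 * δ)⌋₊ + 1) ^ d with hm
  refine ⟨C' * (1 + 2 * m), by positivity, ?_⟩
  intro X hX hXc ρ _ κ _ _ hJ _ hκ hHol ζ hζ hη n hn C₀ hC₀ hC₀'
  obtain ⟨x₀⟩ : Nonempty X := by
    have : Nonempty (X × Label) := nonempty_of_isProbabilityMeasure ρ
    exact this.map Prod.fst
  -- A domain carrying a probability measure has a point, and there `|η - 1/2| ≤ 1/2`; without this,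
  -- `log (1 / ζ)` could be negative.
  have hζ2 : ζ < 1 / 2 := by
    refine (hη x₀).trans_le ?_
    have h0 : 0 ≤ eta κ x₀ := measureReal_nonneg
    have h1 : eta κ x₀ ≤ 1 := measureReal_le_one
    rw [abs_le]
    constructor <;> linarith
  set lam := Real.log (1 / ζ) with hlam
  have hlam1 : 1 ≤ 2 * lam := by
    have h1 : Real.log 2 ≤ lam := Real.log_le_log (by norm_num) (by
      rw [le_div_iff₀ hζ]; linarith)
    have := Real.log_two_gt_d9
    linarith
  have hZ : 1 ≤ ζ ^ (-((d : ℝ) / α)) :=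
    Real.one_le_rpow_of_pos_of_le_one_of_nonpos hζ (by linarith)
      (neg_nonpos.2 (by positivity))
  obtain ⟨l, W, S, hl, hlC, hW, hS, hF⟩ := happrox ζ hζ hζ2
  set V := ζ ^ (-((d : ℝ) / α)) * lam with hV
  have hlV : lam ≤ V := le_mul_of_one_le_left (by linarith) hZ
  have hnV : (n : ℝ) ≤ 2 * V * n := le_mul_of_one_le_left (by positivity) (by linarith)
  -- Without admissible samples `n` need not be bounded by `m`; but then the conditional measure is
  -- zero, and a network of depth `1` and width `0` satisfies all claims.
  by_cases hadm : (admissible X n δ).Nonempty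
  · obtain ⟨D₀, hD₀⟩ := hadm
    have hnm : (n : ℝ) ≤ m := by exact_mod_cast card_le_of_admissible hδ hXc hD₀
    obtain ⟨F, hFc, hFK, hFη⟩ := hHol
    obtain ⟨g, hgr, hg⟩ := hF F hFc hFK
    obtain ⟨N, hN, hN'⟩ := exists_learning_rules hX hJ hδ hκ hη hn hC₀ hC₀'
      (fun z => realizes_bumped (n := n) hgr hl _ _ _ _)
      (fun x => by rw [← hFη x]; exact hg x (hXc x.2))
    have hlC' : (l : ℝ) ≤ C * V := hlC.trans (mul_le_mul_of_nonneg_left hlV hC.le)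
    have hb0 : (0 : ℝ) ≤ bumpSize d := Nat.cast_nonneg _
    have hd0 : (0 : ℝ) ≤ d := Nat.cast_nonneg _
    have hwidth : ((W + (l + 1) + 2 * (n * (2 * d + 1) + l) : ℕ) : ℝ) ≤ C' * (V + n) := by
      push_cast
      have e : C' * (V + n) = 4 * (C * V) + 4 * V + (2 * (2 * d + 1) * n) +
          (2 * (d + 2) + 2 * (2 * d + 1) + 2 * bumpSize d) * V +
          (4 * C + 2 * (d + 2) + 2 * bumpSize d + 4) * n := by rw [hC']; ring
      have e1 : 0 ≤ (2 * ((d : ℝ) + 2) + 2 * (2 * d + 1) + 2 * bumpSize d) * V :=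
        mul_nonneg (by positivity) (by linarith)
      have e2 : 0 ≤ (4 * C + 2 * ((d : ℝ) + 2) + 2 * bumpSize d + 4) * n := by positivity
      rw [e]
      linarith
    have hsize : ((S + (l + (d + 2)) + 2 * (n * bumpSize d + l) : ℕ) : ℝ) ≤ C' * (V + n) := by
      push_cast
      have e : C' * (V + n) = 4 * (C * V) + (d + 2) * (2 * V) + 2 * (bumpSize d * n) +
          (2 * (2 * d + 1) + 2 * bumpSize d + 4) * V +
          (4 * C + 2 * (d + 2) + 2 * (2 * d + 1) + 4) * n := by rw [hC']; ring
      have e1 : 0 ≤ (2 * (2 * (d : ℝ) + 1) + 2 * bumpSize d + 4) * V :=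
        mul_nonneg (by positivity) (by linarith)
      have e2 : 0 ≤ (4 * C + 2 * ((d : ℝ) + 2) + 2 * (2 * d + 1) + 4) * n := by positivity
      have e3 : ((d : ℝ) + 2) * 1 ≤ (d + 2) * (2 * V) :=
        mul_le_mul_of_nonneg_left (by linarith) (by positivity)
      rw [e]
      linarith
    refine ⟨l + 1, fun _ => W + (l + 1) + 2 * (n * (2 * d + 1) + l), by omega, ?_,
      fun _ _ => hwidth, fun _ _ _ => hwidth.trans ?_, N, fun D hD =>
        ⟨(hN D hD).1, fun j => ?_⟩, hN'⟩
    · push_cast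
      have e : C' * lam = C * lam + 2 * lam +
          (3 * C + 2 * (d + 2) + 2 * (2 * d + 1) + 2 * bumpSize d + 2) * lam := by
        rw [hC']; ring
      have e1 : 0 ≤ (3 * C + 2 * ((d : ℝ) + 2) + 2 * (2 * d + 1) + 2 * bumpSize d + 2) * lam :=
        mul_nonneg (by positivity) (by linarith)
      rw [e]
      linarith
    · have e : (n : ℝ) ≤ 2 * m * V := by
        have := mul_le_mul_of_nonneg_left hnm (by linarith : 0 ≤ 2 * V)
        linarith
      calc C' * (V + n) ≤ C' * (V + 2 * m * V) :=
            mul_le_mul_of_nonneg_left (by linarith) hC'0.le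
        _ = _ := by ring
    · obtain ⟨h1, h2, h3, h4⟩ := (hN D hD).2 j
      exact ⟨h1, le_trans (by exact_mod_cast h2) hsize, h3, h4⟩
  · rw [Set.not_nonempty_iff_eq_empty] at hadm
    have hV0 : 0 ≤ V := by linarith
    refine ⟨1, fun _ => 0, le_rfl, ?_, fun _ _ => ?_, fun _ _ _ => ?_,
      fun _ _ => ⟨fun _ => 0, fun _ => 0, 0⟩, fun D hD => ?_, fun j => ?_⟩
    · have : 2 * lam ≤ C' * lam := mul_le_mul_of_nonneg_right (by
        rw [hC']
        have : (0 : ℝ) ≤ bumpSize d := Nat.cast_nonneg _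
        have : (0 : ℝ) ≤ d := Nat.cast_nonneg _
        linarith) (by linarith)
      push_cast
      linarith
    · push_cast
      positivity
    · push_cast
      positivity
    · rw [hadm] at hD
      exact hD.elim
    · have h0 : cond (Measure.pi fun _ : Fin n => ρ) (admissible X n δ) = 0 :=
        cond_eq_zero_of_meas_eq_zero (by rw [hadm, measure_empty])
      rw [h0]
      refine ⟨integrable_zero_measure, ?_, integrable_zero_measure, ?_⟩
      · rw [integral_zero_measure]; positivity
      · rw [integral_zero_measure]; positivity
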